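/- Let $\mathcal X,\mathcal Y,\mathcal Z$ be finite alphabets, $P_{XY}$ a pmf on $\mathcal X\times\mathcal Y$, $d\colon\mathcal X\times\mathcal Z\to[0,\infty)$ a per-symbol distortion function and $D>0$. Let $(X_i,Y_i)_{i\ge1}$ be i.i.d. with pmf $P_{XY}$. For $\epsilon\in[0,1)$, a rate $R>0$ is called $\epsilon$-achievable if there are sequences (in the blocklength $n$) of encoders $\phi^{(n)}\colon\mathcal X^n\to\{0,1\}^{\lceil nR\rceil}$ and decoders $g^{(n)}\colon\{0,1\}^{\lceil nR\rceil}\times\mathcal Y^n\to\mathcal Z^n$ such that, with $Z^n=g^{(n)}(\phi^{(n)}(X^n),Y^n)$, $$\varlimsup_{n\to\infty}\Pr\Big[\frac1n\sum_{i=1}^n d(X_i,Z_i)>D\Big]\le\epsilon .$$ Define $$R_{\min}:=\min_{\substack{P_{S|X},\,P_{Z|SY}:\\ \mathbb E[d(X,Z)]\le D}} I(X;S|Y),$$ where $S$ ranges over all random variables with a finite alphabet, the expectation and the conditional mutual information (in bits) are computed for the pmf $P_{SXYZ}=P_{S|X}P_{XY}P_{Z|SY}$, and $R_{\min}:=+\infty$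 if no choice of $P_{S|X},P_{Z|SY}$ satisfies the constraint. Then the minimum is attained whenever the constraint can be satisfied, and for every $\epsilon\in[0,1)$ no rate $R$ with $0<R<R_{\min}$ is $\epsilon$-achievable. -/

import Mathlib

namespace WynerZiv

/-- The pmf of the random variable `f` on the finite probability space with pmf `p`. -/
noncomputable def law {Ω A : Type*} [Fintype Ω] (p : Ω → ℝ) (f : Ω → A) (a : A) : ℝ :=
  open Classical in ∑ ω, if f ω = a then p ω else 0

/-- Shannon entropy `H(f)`, in bits, of the random variable `f` under the pmf `p`. -/
noncomputable def entropy {Ω A : Type*} [Fintype Ω] [Fintype A] (p : Ω → ℝ) (f : Ω → A) : ℝ :=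
  (∑ a, Real.negMulLog (law p f a)) / Real.log 2

/-- Conditional entropy `H(f | h) = H(f, h) - H(h)`, in bits. -/
noncomputable def condEntropy {Ω A C : Type*} [Fintype Ω] [Fintype A] [Fintype C]
    (p : Ω → ℝ) (f : Ω → A) (h : Ω → C) : ℝ :=
  entropy p (fun ω => (f ω, h ω)) - entropy p h

/-- Conditional mutual information `I(f; g | h) = H(f | h) - H(f | g, h)`, in bits. -/
noncomputable def condMutualInfo {Ω A B C : Type*} [Fintype Ω] [Fintype A] [Fintype B] [Fintype C]
    (p : Ω → ℝ) (f : Ω → A) (g : Ω → B) (h : Ω → C) : ℝ :=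
  condEntropy p f h - condEntropy p f (fun ω => (g ω, h ω))

/-- The function `(s, x, y, z) ↦ P_{S|X}(s|x) P_{XY}(x,y) P_{Z|SY}(z|s,y)`, where
`W x s = P_{S|X}(s|x)` and `V s y z = P_{Z|SY}(z|s,y)`. -/
noncomputable def jointPmf {X Y Z S : Type*} (P : X × Y → ℝ) (W : X → S → ℝ)
    (V : S → Y → Z → ℝ) : S × X × Y × Z → ℝ :=
  fun ω => W ω.2.1 ω.1 * P (ω.2.1, ω.2.2.1) * V ω.1 ω.2.2.1 ω.2.2.2

/-- The values `I(X;S|Y)` over all finite alphabets of `S` and all conditional pmfs `P_{S|X}`,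
`P_{Z|SY}` with `E[d(X,Z)] ≤ D`. -/
def feasibleRates {X Y Z : Type*} [Fintype X] [Fintype Y] [Fintype Z]
    (P : X × Y → ℝ) (d : X → Z → ℝ) (D : ℝ) : Set ℝ :=
  {r | ∃ (k : ℕ) (W : X → Fin k → ℝ) (V : Fin k → Y → Z → ℝ),
    (∀ x, W x ∈ stdSimplex ℝ (Fin k)) ∧ (∀ s y, V s y ∈ stdSimplex ℝ Z) ∧
    ∑ ω, jointPmf P W V ω * d ω.2.1 ω.2.2.2 ≤ D ∧
    r = condMutualInfo (jointPmf P W V) (fun ω => ω.2.1) (fun ω => ω.1) (fun ω => ω.2.2.1)}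

/-- `R_min`, the infimum of the feasible rates; it is `⊤` if the distortion constraint cannot
be met. -/
noncomputable def Rmin {X Y Z : Type*} [Fintype X] [Fintype Y] [Fintype Z]
    (P : X × Y → ℝ) (d : X → Z → ℝ) (D : ℝ) : EReal :=
  ⨅ r ∈ feasibleRates P d D, (r : EReal)

/-- `Pr[(1/n) ∑ d(X_i, Z_i) > D]` for `(X^n, Y^n)` i.i.d. with pmf `P` and
`Z^n = g(φ(X^n), Y^n)`. -/
noncomputable def excessProb {X Y Z M : Type*} [Fintype X] [Fintype Y]
    (P : X × Y → ℝ) (d : X → Z → ℝ) (D : ℝ) {n : ℕ}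
    (φ : (Fin n → X) → M) (g : M → (Fin n → Y) → (Fin n → Z)) : ℝ :=
  open Classical in
  ∑ ω : Fin n → X × Y,
    if D < (1 / (n : ℝ)) * ∑ i, d (ω i).1 (g (φ fun j => (ω j).1) (fun j => (ω j).2) i)
    then ∏ i, P (ω i) else 0

/-- `R` is `ε`-achievable: some sequence of codes with messages of `⌈nR⌉` bits has asymptotic
excess-distortion probability at most `ε`. -/
def Achievable {X Y Z : Type*} [Fintype X] [Fintype Y]
    (P : X × Y → ℝ) (d : X → Z → ℝ) (D ε R : ℝ) : Prop :=
  ∃ (φ : ∀ n : ℕ, (Fin n → X) → (Fin ⌈(n : ℝ) * R⌉₊ → Bool))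
    (g : ∀ n : ℕ, (Fin ⌈(n : ℝ) * R⌉₊ → Bool) → (Fin n → Y) → (Fin n → Z)),
    Filter.limsup (fun n => excessProb P d D (φ n) (g n)) Filter.atTop ≤ ε

end WynerZiv

namespace WynerZiv

open Finset Filter Topology

/-! The strong converse is proved by a change of measure. If the excess-distortion probability of a
code is eventually below some `c < 1`, the event `G` on which the distortion is at most `D` has
probability at least `1 - c`. Conditioning the i.i.d. source on `G` makes the distortion constraint
hold surely and costs only the relative entropy `-log Pr[G]`, which is bounded independently of `n`.

Under the conditioned law the source is no longer i.i.d., but the entropy of `(X^n, Y^n)` is within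
a constant `β` of `n H(X_T, Y_T)`, with `T` uniform (`entropy_conditionedLaw`,
`conditionedLaw_gibbs`). Take the auxiliary variable `S = (T, M, X^{T-1}, Y_{T+1}^n)`. Telescoping
sums of entropies bound `I(X_T; S | Y_T)` by `(log |M| + β) / n`, and show that the Markov chains `S
- X - Y` and `Z - (S, Y) - X` fail by at most `β / n` of conditional mutual information
(`exists_isFeasiblePoint_of_code`).

It remains to let `n → ∞` although the alphabet of `S` grows. For this `S` is forgotten: only the
law of `(X, Y, Z)` and the averages `H(X|Y,S)`, `H(Y|X,S)`, `H(X|Y,Z,S)` are kept. These vectors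
form the convex hull of a compact set in finite dimension, which is compact, and every constraint is
closed there. A limit point satisfies the constraints exactly, and the equality case of Gibbs'
inequality turns it back into channels `P_{S|X}`, `P_{Z|SY}` (`feasibleRates_eq_image`). The same
compactness shows that the minimum is attained. -/

/-- In a finite-dimensional real space the convex hull of a compact set is compact. -/
theorem isCompact_convexHull_of_finiteDimensional {E : Type*} [NormedAddCommGroup E]
    [NormedSpace ℝ E] [FiniteDimensional ℝ E] {s : Set E} (hs : IsCompact s) :
    IsCompact (convexHull ℝ s) := by
  classical
  let N := Module.finrank ℝ E + 1
  let F : (Fin N → ℝ) × (Fin N → E) → E := fun t => ∑ i, t.1 i • t.2 i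
  have hF : Continuous F := by fun_prop
  have hK : IsCompact (stdSimplex ℝ (Fin N) ×ˢ Set.pi Set.univ fun _ : Fin N => s) :=
    (isCompact_stdSimplex ℝ (Fin N)).prod (isCompact_univ_pi fun _ => hs)
  convert hK.image hF using 1
  ext x
  constructor
  · intro hx
    obtain ⟨ι, _, z, w, hz, hind, hw, hw1, rfl⟩ := eq_pos_convex_span_of_mem_convexHull hx
    have hcard : Fintype.card ι ≤ Fintype.card (Fin N) := by
      simpa [N] using hind.card_le_finrank_succ.trans
        (Nat.succ_le_succ (Submodule.finrank_le _))
    obtain ⟨e⟩ := Function.Embedding.nonempty_of_card_le hcard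
    have hne : Nonempty ι := by
      by_contra h
      rw [not_nonempty_iff] at h
      simp at hw1
    obtain ⟨i₀⟩ := hne
    -- Carathéodory may use fewer than `N` points. The list is padded with weight `0`, and the
    -- padding repeats a genuine point so that every entry stays in `s`.
    let w' : Fin N → ℝ := Function.extend e w 0
    let z' : Fin N → E := Function.extend e z fun _ => z i₀
    have hout : ∀ j, j ∉ Set.range e → w' j = 0 := fun j hj => by
      simp [w', Function.extend_apply' _ _ _ hj]
    refine ⟨(w', z'), ⟨⟨fun j => ?_, ?_⟩, fun j _ => ?_⟩, ?_⟩
    · by_cases hj : j ∈ Set.range e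
      · obtain ⟨i, rfl⟩ := hj
        simpa [w', e.injective.extend_apply] using (hw i).le
      · exact (hout j hj).ge
    · rw [← hw1]
      exact (Fintype.sum_of_injective e e.injective w w' hout
        fun i => by simp [w', e.injective.extend_apply]).symm
    · by_cases hj : j ∈ Set.range e
      · obtain ⟨i, rfl⟩ := hj
        simpa [z', e.injective.extend_apply] using hz ⟨i, rfl⟩
      · simpa [z', Function.extend_apply' _ _ _ hj] using hz ⟨i₀, rfl⟩
    · exact (Fintype.sum_of_injective e e.injective (fun i => w i • z i) (fun j => w' j • z' j)
        (fun j hj => by simp [hout j hj])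
        fun i => by simp [w', z', e.injective.extend_apply]).symm
  · rintro ⟨⟨w, z⟩, ⟨hw, hz⟩, rfl⟩
    exact mem_convexHull_of_exists_fintype w z hw.1 hw.2 (fun i => hz i trivial) rfl

/-! ### Gibbs' inequality -/

/-- This is `b * klFun (a / b) ≥ 0` multiplied out; summing it over an alphabet gives Gibbs'
inequality, and its equality case gives uniqueness. -/
theorem sub_le_mul_log_sub_mul_log {a b : ℝ} (ha : 0 ≤ a) (hb : 0 ≤ b) (hab : b = 0 → a = 0) :
    a - b ≤ a * Real.log a - a * Real.log b := by
  rcases hb.eq_or_lt with rfl | hb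
  · simp [hab rfl]
  rcases ha.eq_or_lt with rfl | ha
  · simpa using hb.le
  have h := InformationTheory.klFun_nonneg (div_nonneg ha.le hb.le)
  rw [InformationTheory.klFun_apply, Real.log_div ha.ne' hb.ne'] at h
  have h' := mul_nonneg hb.le h
  have : b * (a / b * (Real.log a - Real.log b) + 1 - a / b)
      = a * Real.log a - a * Real.log b - (a - b) := by
    field_simp
    ring
  linarith

theorem eq_of_mul_log_sub_mul_log_eq {a b : ℝ} (ha : 0 ≤ a) (hb : 0 ≤ b) (hab : b = 0 → a = 0)
    (h : a * Real.log a - a * Real.log b = a - b) : a = b := by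
  rcases hb.eq_or_lt with rfl | hb
  · exact hab rfl
  rcases ha.eq_or_lt with rfl | ha
  · simp at h; linarith
  have h' : InformationTheory.klFun (a / b) = 0 := by
    rw [InformationTheory.klFun_apply, Real.log_div ha.ne' hb.ne']
    field_simp
    linarith
  rw [InformationTheory.klFun_eq_zero_iff (div_nonneg ha.le hb.le)] at h'
  rwa [div_eq_one_iff_eq hb.ne'] at h'

/-- Gibbs' inequality. -/
theorem sum_mul_log_le_sum_mul_log {ι : Type*} [Fintype ι] {a b : ι → ℝ} (ha : ∀ i, 0 ≤ a i)
    (hb : ∀ i, 0 ≤ b i) (hab : ∀ i, b i = 0 → a i = 0) (hsum : ∑ i, b i ≤ ∑ i, a i) :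
    ∑ i, a i * Real.log (b i) ≤ ∑ i, a i * Real.log (a i) := by
  have h : ∑ i, (a i - b i) ≤ ∑ i, (a i * Real.log (a i) - a i * Real.log (b i)) :=
    sum_le_sum fun i _ => sub_le_mul_log_sub_mul_log (ha i) (hb i) (hab i)
  simp only [sum_sub_distrib] at h
  linarith

/-- The equality case of Gibbs' inequality. -/
theorem eq_of_sum_mul_log_le {ι : Type*} [Fintype ι] {a b : ι → ℝ} (ha : ∀ i, 0 ≤ a i)
    (hb : ∀ i, 0 ≤ b i) (hab : ∀ i, b i = 0 → a i = 0) (hsum : ∑ i, b i ≤ ∑ i, a i)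
    (h : ∑ i, a i * Real.log (a i) ≤ ∑ i, a i * Real.log (b i)) : a = b := by
  have hle : ∀ i ∈ univ, a i - b i ≤ a i * Real.log (a i) - a i * Real.log (b i) :=
    fun i _ => sub_le_mul_log_sub_mul_log (ha i) (hb i) (hab i)
  have heq : ∑ i, (a i - b i) = ∑ i, (a i * Real.log (a i) - a i * Real.log (b i)) := by
    refine le_antisymm (sum_le_sum hle) ?_
    simp only [sum_sub_distrib]
    linarith
  funext i
  exact eq_of_mul_log_sub_mul_log_eq (ha i) (hb i) (hab i)
    ((sum_eq_sum_iff_of_le hle).1 heq i (mem_univ i)).symm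

/-! ### Laws of random variables -/

section Law

variable {Ω A B C : Type*} [Fintype Ω]

theorem law_nonneg {p : Ω → ℝ} (hp : ∀ ω, 0 ≤ p ω) (f : Ω → A) (a : A) : 0 ≤ law p f a :=
  sum_nonneg fun ω _ => by split_ifs <;> simp [hp]

theorem le_law {p : Ω → ℝ} (hp : ∀ ω, 0 ≤ p ω) (f : Ω → A) (ω : Ω) : p ω ≤ law p f (f ω) := by
  classical
  unfold law
  refine le_trans (by simp) (single_le_sum (f := fun ω' => if f ω' = f ω then p ω' else 0)
    (fun ω' _ => ?_) (mem_univ ω))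
  split_ifs <;> simp [hp]

theorem sum_law_mul [Fintype A] (p : Ω → ℝ) (f : Ω → A) (F : A → ℝ) :
    ∑ a, law p f a * F a = ∑ ω, p ω * F (f ω) := by
  classical
  simp only [law, sum_mul, ite_mul, zero_mul]
  rw [sum_comm]
  simp

theorem sum_law [Fintype A] (p : Ω → ℝ) (f : Ω → A) : ∑ a, law p f a = ∑ ω, p ω := by
  simpa using sum_law_mul p f fun _ => 1

theorem law_law [Fintype A] (p : Ω → ℝ) (f : Ω → A) (g : A → B) (b : B) :
    law (law p f) g b = law p (fun ω => g (f ω)) b := by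
  classical
  have h := sum_law_mul p f fun a => if g a = b then (1 : ℝ) else 0
  simp only [mul_ite, mul_one, mul_zero] at h
  simpa [law] using h

theorem sum_law_prod_right [Fintype B] (p : Ω → ℝ) (f : Ω → A) (g : Ω → B) (a : A) :
    ∑ b, law p (fun ω => (f ω, g ω)) (a, b) = law p f a := by
  classical
  simp only [law, Prod.mk.injEq]
  rw [sum_comm]
  refine sum_congr rfl fun ω _ => ?_
  by_cases h : f ω = a <;> simp [h]

theorem sum_law_prod_left [Fintype A] (p : Ω → ℝ) (f : Ω → A) (g : Ω → B) (b : B) :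
    ∑ a, law p (fun ω => (f ω, g ω)) (a, b) = law p g b := by
  classical
  simp only [law, Prod.mk.injEq]
  rw [sum_comm]
  refine sum_congr rfl fun ω _ => ?_
  by_cases h : g ω = b <;> simp [h]

theorem law_congr (p : Ω → ℝ) {f : Ω → A} {g : Ω → B}
    (h : ∀ ω ω', f ω = f ω' ↔ g ω = g ω') (ω : Ω) : law p f (f ω) = law p g (g ω) := by
  classical
  unfold law
  refine sum_congr rfl fun ω' _ => ?_
  by_cases h' : f ω' = f ω
  · simp [h', (h ω' ω).1 h']
  · rw [if_neg h', if_neg fun h'' => h' ((h ω' ω).2 h'')]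

theorem law_le_law {p : Ω → ℝ} (hp : ∀ ω, 0 ≤ p ω) {f : Ω → A} {g : Ω → B} {a : A} {b : B}
    (h : ∀ ω, f ω = a → g ω = b) : law p f a ≤ law p g b := by
  classical
  refine sum_le_sum fun ω _ => ?_
  by_cases h' : f ω = a
  · simp [h', h ω h']
  · simp only [h', if_false]
    split_ifs <;> simp [hp]

theorem law_eq_zero_of_imp {p : Ω → ℝ} (hp : ∀ ω, 0 ≤ p ω) {f : Ω → A} {g : Ω → B} {a : A} {b : B}
    (h : ∀ ω, f ω = a → g ω = b) (h0 : law p g b = 0) : law p f a = 0 :=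
  le_antisymm ((law_le_law hp h).trans h0.le) (law_nonneg hp f a)

theorem continuous_law (f : Ω → A) (a : A) : Continuous fun p : Ω → ℝ => law p f a := by
  classical
  unfold law
  refine continuous_finsetSum _ fun ω _ => ?_
  split_ifs <;> fun_prop

theorem law_id (p : Ω → ℝ) : law p (fun ω => ω) = p := by
  classical
  funext a
  simp [law]

theorem law_smul (c : ℝ) (p : Ω → ℝ) (f : Ω → A) (a : A) :
    law (fun ω => c * p ω) f a = c * law p f a := by
  classical
  simp [law, mul_sum, mul_ite]

theorem law_eq_law (p : Ω → ℝ) {f : Ω → A} {g : Ω → B} {a : A} {b : B}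
    (h : ∀ ω, f ω = a ↔ g ω = b) : law p f a = law p g b := by
  classical
  exact sum_congr rfl fun ω _ => if_congr (h ω) rfl rfl

/-- The law the triple would have if its first two entries were independent given the third. -/
noncomputable def condProductLaw (p : Ω → ℝ) (f : Ω → A) (g : Ω → B) (h : Ω → C)
    (t : A × B × C) : ℝ :=
  law p (fun ω => (f ω, h ω)) (t.1, t.2.2) * law p (fun ω => (g ω, h ω)) (t.2.1, t.2.2)
    / law p h t.2.2

theorem condProductLaw_nonneg {p : Ω → ℝ} (hp : ∀ ω, 0 ≤ p ω) (f : Ω → A) (g : Ω → B) (h : Ω → C)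
    (t : A × B × C) : 0 ≤ condProductLaw p f g h t :=
  div_nonneg (mul_nonneg (law_nonneg hp _ _) (law_nonneg hp _ _)) (law_nonneg hp _ _)

theorem law_eq_zero_of_condProductLaw_eq_zero {p : Ω → ℝ} (hp : ∀ ω, 0 ≤ p ω) (f : Ω → A)
    (g : Ω → B) (h : Ω → C) (t : A × B × C) (ht : condProductLaw p f g h t = 0) :
    law p (fun ω => (f ω, g ω, h ω)) t = 0 := by
  obtain ⟨a, b, c⟩ := t
  rw [condProductLaw, div_eq_zero_iff, mul_eq_zero] at ht
  rcases ht with (ht | ht) | ht <;> refine law_eq_zero_of_imp hp (fun ω hω => ?_) ht <;>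
    simp_all

end Law

/-! ### Entropy -/

section Entropy

variable {Ω A B C : Type*} [Fintype Ω] [Fintype A] [Fintype B] [Fintype C]

theorem log_two_pos : 0 < Real.log 2 := Real.log_pos one_lt_two

theorem entropy_mul_log_two (p : Ω → ℝ) (f : Ω → A) :
    entropy p f * Real.log 2 = -∑ a, law p f a * Real.log (law p f a) := by
  rw [entropy, div_mul_cancel₀ _ log_two_pos.ne', ← sum_neg_distrib]
  exact sum_congr rfl fun a _ => by simp [Real.negMulLog]

theorem entropy_mul_log_two_eq_sum (p : Ω → ℝ) (f : Ω → A) :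
    entropy p f * Real.log 2 = -∑ ω, p ω * Real.log (law p f (f ω)) := by
  rw [entropy_mul_log_two, sum_law_mul p f fun a => Real.log (law p f a)]

/-- Entropy depends only on the partition induced by the random variable. -/
theorem entropy_congr (p : Ω → ℝ) {f : Ω → A} {g : Ω → B}
    (h : ∀ ω ω', f ω = f ω' ↔ g ω = g ω') : entropy p f = entropy p g := by
  refine mul_right_cancel₀ log_two_pos.ne' ?_
  rw [entropy_mul_log_two_eq_sum, entropy_mul_log_two_eq_sum]
  simp only [law_congr p h]

theorem entropy_law (p : Ω → ℝ) (f : Ω → A) (g : A → B) :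
    entropy (law p f) g = entropy p fun ω => g (f ω) := by
  simp only [entropy, law_law]

theorem continuous_entropy (f : Ω → A) : Continuous fun p : Ω → ℝ => entropy p f := by
  unfold entropy
  refine Continuous.div_const (continuous_finsetSum _ fun a _ => ?_) _
  exact Real.continuous_negMulLog.comp (continuous_law f a)

theorem continuous_condEntropy (f : Ω → A) (h : Ω → C) :
    Continuous fun p : Ω → ℝ => condEntropy p f h :=
  (continuous_entropy _).sub (continuous_entropy _)

theorem entropy_smul (c : ℝ) (p : Ω → ℝ) (f : Ω → A) :
    entropy (fun ω => c * p ω) f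
      = c * entropy p f + Real.negMulLog c * (∑ ω, p ω) / Real.log 2 := by
  simp only [entropy, law_smul, Real.negMulLog_mul, sum_add_distrib, ← sum_mul, ← mul_sum,
    sum_law]
  ring

/-- The correction term in `entropy_smul` involves only the total mass, so it cancels in the
difference. This homogeneity lets the slices of a joint law be used without normalizing them. -/
theorem condEntropy_smul (c : ℝ) (p : Ω → ℝ) (f : Ω → A) (h : Ω → C) :
    condEntropy (fun ω => c * p ω) f h = c * condEntropy p f h := by
  simp only [condEntropy, entropy_smul]
  ring

theorem sum_condProductLaw (p : Ω → ℝ) (f : Ω → A) (g : Ω → B) (h : Ω → C) :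
    ∑ t, condProductLaw p f g h t = ∑ ω, p ω := by
  rw [← sum_law p h]
  simp only [Fintype.sum_prod_type, condProductLaw]
  have : ∀ a, ∑ b, ∑ c, law p (fun ω => (f ω, h ω)) (a, c) * law p (fun ω => (g ω, h ω)) (b, c)
      / law p h c = ∑ c, law p (fun ω => (f ω, h ω)) (a, c) * law p h c / law p h c := fun a => by
    rw [sum_comm]
    refine sum_congr rfl fun c _ => ?_
    rw [← sum_div, ← mul_sum, sum_law_prod_left]
  simp only [this]
  rw [sum_comm]
  refine sum_congr rfl fun c _ => ?_
  rw [← sum_div, ← sum_mul, sum_law_prod_left]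
  -- This also covers `law p h c = 0`, where division by zero returns `0`.
  exact mul_self_div_self _

theorem sum_law_mul_log_condProductLaw {p : Ω → ℝ} (hp : ∀ ω, 0 ≤ p ω) (f : Ω → A) (g : Ω → B)
    (h : Ω → C) :
    ∑ t, law p (fun ω => (f ω, g ω, h ω)) t * Real.log (condProductLaw p f g h t) =
      (entropy p h - entropy p (fun ω => (f ω, h ω)) - entropy p (fun ω => (g ω, h ω)))
        * Real.log 2 := by
  rw [sum_law_mul, sub_mul, sub_mul, entropy_mul_log_two_eq_sum, entropy_mul_log_two_eq_sum,
    entropy_mul_log_two_eq_sum, ← sub_eq_zero]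
  simp only [← sum_neg_distrib, ← sum_sub_distrib]
  refine sum_eq_zero fun ω _ => ?_
  rcases (hp ω).eq_or_lt with h0 | h0
  · simp [← h0]
  have h1 := h0.trans_le (le_law hp (fun ω => (f ω, h ω)) ω)
  have h2 := h0.trans_le (le_law hp (fun ω => (g ω, h ω)) ω)
  have h3 := h0.trans_le (le_law hp h ω)
  simp only [condProductLaw]
  rw [Real.log_div (mul_pos h1 h2).ne' h3.ne', Real.log_mul h1.ne' h2.ne']
  ring

/-- Strong subadditivity of entropy. -/
theorem entropy_submodular {p : Ω → ℝ} (hp : ∀ ω, 0 ≤ p ω) (f : Ω → A) (g : Ω → B) (h : Ω → C) :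
    entropy p (fun ω => (f ω, g ω, h ω)) + entropy p h
      ≤ entropy p (fun ω => (f ω, h ω)) + entropy p (fun ω => (g ω, h ω)) := by
  have hG := sum_mul_log_le_sum_mul_log (law_nonneg hp fun ω => (f ω, g ω, h ω))
    (condProductLaw_nonneg hp f g h) (law_eq_zero_of_condProductLaw_eq_zero hp f g h)
    (by rw [sum_condProductLaw, sum_law])
  rw [sum_law_mul_log_condProductLaw hp] at hG
  have hE := entropy_mul_log_two p fun ω => (f ω, g ω, h ω)
  refine le_of_mul_le_mul_right ?_ log_two_pos
  linarith

/-- Vanishing conditional mutual information is the equality case of Gibbs' inequality against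
`condProductLaw`. This is how an entropy equality is converted back into a Markov chain. -/
theorem law_eq_condProductLaw {p : Ω → ℝ} (hp : ∀ ω, 0 ≤ p ω) {f : Ω → A} {g : Ω → B} {h : Ω → C}
    (hle : entropy p (fun ω => (f ω, h ω)) + entropy p (fun ω => (g ω, h ω))
      ≤ entropy p (fun ω => (f ω, g ω, h ω)) + entropy p h) :
    law p (fun ω => (f ω, g ω, h ω)) = condProductLaw p f g h := by
  refine eq_of_sum_mul_log_le (law_nonneg hp _)
    (condProductLaw_nonneg hp f g h) (law_eq_zero_of_condProductLaw_eq_zero hp f g h)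
    (by rw [sum_condProductLaw, sum_law]) ?_
  rw [sum_law_mul_log_condProductLaw hp]
  have hE := entropy_mul_log_two p fun ω => (f ω, g ω, h ω)
  have := mul_le_mul_of_nonneg_right hle log_two_pos.le
  linarith

theorem entropy_add_eq_of_law_eq {p : Ω → ℝ} (hp : ∀ ω, 0 ≤ p ω) {f : Ω → A} {g : Ω → B}
    {h : Ω → C} (heq : law p (fun ω => (f ω, g ω, h ω)) = condProductLaw p f g h) :
    entropy p (fun ω => (f ω, h ω)) + entropy p (fun ω => (g ω, h ω))
      = entropy p (fun ω => (f ω, g ω, h ω)) + entropy p h := by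
  have h1 := sum_law_mul_log_condProductLaw hp f g h
  rw [← heq] at h1
  have hE := entropy_mul_log_two p fun ω => (f ω, g ω, h ω)
  refine mul_right_cancel₀ log_two_pos.ne' ?_
  linarith

/-- Conditioning on more reduces entropy. -/
theorem condEntropy_anti {p : Ω → ℝ} (hp : ∀ ω, 0 ≤ p ω) (f : Ω → A) {g : Ω → B} {h : Ω → C}
    (hgh : ∀ ω ω', g ω = g ω' → h ω = h ω') : condEntropy p f g ≤ condEntropy p f h := by
  have := entropy_submodular hp f g h
  rw [entropy_congr p (f := fun ω => (f ω, g ω, h ω)) (g := fun ω => (f ω, g ω)),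
    entropy_congr p (f := fun ω => (g ω, h ω)) (g := g)] at this
  · simp only [condEntropy]; linarith
  · intro ω ω'; simpa using hgh ω ω'
  · intro ω ω'; simp only [Prod.mk.injEq]
    exact ⟨fun t => ⟨t.1, t.2.1⟩, fun t => ⟨t.1, t.2, hgh _ _ t.2⟩⟩

theorem entropy_prod_le {p : Ω → ℝ} (hp : p ∈ stdSimplex ℝ Ω) (f : Ω → A) (g : Ω → B) :
    entropy p (fun ω => (f ω, g ω)) ≤ entropy p f + entropy p g := by
  have h := entropy_submodular hp.1 f g fun _ => ()
  rw [entropy_congr p (f := fun ω => (f ω, g ω, ())) (g := fun ω => (f ω, g ω)) (by simp),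
    entropy_congr p (f := fun ω => (f ω, ())) (g := f) (by simp),
    entropy_congr p (f := fun ω => (g ω, ())) (g := g) (by simp)] at h
  have h0 : entropy p (fun _ : Ω => ()) = 0 := by
    simp [entropy, law, hp.2]
  linarith

theorem entropy_le_log_card {p : Ω → ℝ} (hp : p ∈ stdSimplex ℝ Ω) (f : Ω → A) :
    entropy p f * Real.log 2 ≤ Real.log (Fintype.card A) := by
  have hne : Nonempty Ω := by
    by_contra h
    rw [not_nonempty_iff] at h
    simpa using hp.2
  have : Nonempty A := hne.map f
  have hc : (0 : ℝ) < Fintype.card A := by exact_mod_cast Fintype.card_pos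
  have h := sum_mul_log_le_sum_mul_log (a := law p f) (b := fun _ => (Fintype.card A : ℝ)⁻¹)
    (law_nonneg hp.1 f) (fun _ => by positivity) (fun _ h => absurd h (by positivity))
    (by rw [sum_law, hp.2]; simp)
  rw [← sum_mul, sum_law, hp.2, Real.log_inv] at h
  rw [entropy_mul_log_two]
  linarith

/-- The slices over `b` are left unnormalized, so no term for the entropy of `g` appears separately.
-/
theorem entropy_prod_eq_sum {T : Type*} [Fintype T] (p : Ω → ℝ) (g : Ω → B) (τ : Ω → T)
    (k : T → A) :
    entropy p (fun ω => (g ω, k (τ ω)))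
      = ∑ b, entropy (fun t => law p (fun ω => (g ω, τ ω)) (b, t)) k := by
  classical
  simp only [entropy, ← sum_div, Fintype.sum_prod_type]
  congr 1
  refine sum_congr rfl fun b _ => sum_congr rfl fun x _ => ?_
  congr 1
  rw [← law_law p (fun ω => (g ω, τ ω)) fun t => (t.1, k t.2)]
  conv_lhs => unfold law
  rw [Fintype.sum_prod_type, sum_eq_single b]
  · simp [law]
  · intro b' _ hb
    simp [hb]
  · simp

/-- The conditional entropy given `(g, h)` is the average over the values of `g` of the
conditional entropy given `h`. -/
theorem condEntropy_eq_sum {T : Type*} [Fintype T] (p : Ω → ℝ) (g : Ω → B) (τ : Ω → T) (f : T → A)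
    (h : T → C) :
    condEntropy p (fun ω => f (τ ω)) (fun ω => (g ω, h (τ ω)))
      = ∑ b, condEntropy (fun t => law p (fun ω => (g ω, τ ω)) (b, t)) f h := by
  simp only [condEntropy, sum_sub_distrib]
  rw [← entropy_prod_eq_sum p g τ h, ← entropy_prod_eq_sum p g τ fun t => (f t, h t)]
  congr 1
  exact entropy_congr p fun ω ω' => by
    simp only [Prod.mk.injEq]; tauto

/-- The entropy of a block is at most its length times the entropy of the time-averaged law. -/
theorem entropy_pi_le {n : ℕ} {p : Ω → ℝ} (hp : p ∈ stdSimplex ℝ Ω) (f : Fin n → Ω → A) (q : A → ℝ)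
    (hq : ∀ a, ∑ i, law p (f i) a = n * q a) :
    entropy p (fun ω i => f i ω) ≤ n * entropy q (fun a => a) := by
  classical
  -- For `n = 0` nothing constrains `q`, but there is only one empty block and its entropy is at
  -- most `log 1`.
  rcases Nat.eq_zero_or_pos n with rfl | hn
  · have := entropy_le_log_card hp (fun ω (i : Fin 0) => f i ω)
    simp only [Fintype.card_unique, Nat.cast_one, Real.log_one] at this
    have h2 := log_two_pos
    simp only [Nat.cast_zero, zero_mul]
    nlinarith
  have hn' : (0 : ℝ) < n := by exact_mod_cast hn
  have hle : ∀ i a, law p (f i) a ≤ n * q a := fun i a => by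
    rw [← hq]
    exact single_le_sum (f := fun i => law p (f i) a) (fun j _ => law_nonneg hp.1 _ _) (mem_univ i)
  have hq0 : ∀ a, 0 ≤ q a := fun a => by
    have := (law_nonneg hp.1 (f ⟨0, hn⟩) a).trans (hle _ a)
    exact nonneg_of_mul_nonneg_right this hn'
  have hq1 : ∑ a, q a = 1 := by
    have : ∑ a, (n : ℝ) * q a = n := by
      simp only [← hq]
      rw [sum_comm]
      simp [sum_law, hp.2]
    rw [← mul_sum] at this
    exact mul_left_cancel₀ hn'.ne' (by linarith)
  -- Gibbs' inequality compares the block law with the product of `n` copies of `q`, for which the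
  -- cross-entropy is exactly `n` times the entropy of `q`.
  have hG := sum_mul_log_le_sum_mul_log (a := law p (fun ω i => f i ω))
    (b := fun x => ∏ i, q (x i)) (law_nonneg hp.1 _) (fun x => prod_nonneg fun i _ => hq0 _)
    (fun x hx => by
      obtain ⟨i, -, hi⟩ := prod_eq_zero_iff.1 hx
      refine law_eq_zero_of_imp hp.1 (g := f i) (b := x i) (fun ω hω => by rw [← hω]) ?_
      exact le_antisymm ((hle i _).trans (by simp [hi])) (law_nonneg hp.1 _ _))
    (by
      rw [sum_law, hp.2, ← Fintype.prod_sum (fun (_ : Fin n) a => q a)]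
      simp [hq1])
  have hlog : ∑ x, law p (fun ω i => f i ω) x * Real.log (∏ i, q (x i))
      = n * ∑ a, q a * Real.log (q a) := by
    rw [sum_law_mul]
    have : ∀ ω, p ω * Real.log (∏ i, q (f i ω)) = ∑ i, p ω * Real.log (q (f i ω)) := fun ω => by
      rcases (hp.1 ω).eq_or_lt with h0 | h0
      · simp [← h0]
      -- The logarithm splits because every factor is nonzero at a block of positive mass: `n * q`
      -- dominates each marginal.
      rw [Real.log_prod, mul_sum]
      intro i _ hi
      have := (le_law hp.1 (f i) ω).trans (hle i (f i ω))
      rw [hi, mul_zero] at this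
      linarith
    simp only [this]
    rw [sum_comm]
    have : ∀ i, ∑ ω, p ω * Real.log (q (f i ω)) = ∑ a, law p (f i) a * Real.log (q a) :=
      fun i => (sum_law_mul p (f i) fun a => Real.log (q a)).symm
    simp only [this]
    rw [sum_comm, mul_sum]
    refine sum_congr rfl fun a _ => ?_
    rw [← sum_mul, hq, mul_assoc]
  rw [hlog] at hG
  refine le_of_mul_le_mul_right ?_ log_two_pos
  rw [mul_assoc, entropy_mul_log_two, entropy_mul_log_two, law_id]
  linarith

/-- If the law of `(f, g, h)` factorizes, then `f` and `g` are independent given `h`. -/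
theorem law_eq_condProductLaw_of_factor {C : Type*} {p : Ω → ℝ} (hp : ∀ ω, 0 ≤ p ω) {f : Ω → A}
    {g : Ω → B} {h : Ω → C} (u : A → C → ℝ) (v : B → C → ℝ)
    (huv : ∀ a b c, law p (fun ω => (f ω, g ω, h ω)) (a, b, c) = u a c * v b c) :
    law p (fun ω => (f ω, g ω, h ω)) = condProductLaw p f g h := by
  funext ⟨a, b, c⟩
  have hf : ∀ a, law p (fun ω => (f ω, h ω)) (a, c) = u a c * ∑ b, v b c := fun a => by
    rw [mul_sum, ← sum_law_prod_right p _ g]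
    refine sum_congr rfl fun b _ => ?_
    rw [← huv]
    exact law_eq_law p fun ω => by simp only [Prod.mk.injEq]; tauto
  have hg : law p (fun ω => (g ω, h ω)) (b, c) = (∑ a, u a c) * v b c := by
    rw [sum_mul, ← sum_law_prod_left p f]
    exact sum_congr rfl fun a _ => huv a b c
  have hh : law p h c = (∑ a, u a c) * ∑ b, v b c := by
    rw [← sum_law_prod_left p f, sum_mul]
    exact sum_congr rfl fun a _ => hf a
  by_cases h0 : law p h c = 0
  · rw [condProductLaw, h0, div_zero]
    exact law_eq_zero_of_imp hp (fun ω hω => by simp_all) h0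
  · rw [condProductLaw, eq_div_iff h0]
    simp only
    rw [huv, hf, hg, hh]
    ring

end Entropy

/-! ### The compact region of averaged conditional entropies -/

section Region

variable {X Y Z : Type*} [Fintype X] [Fintype Y] [Fintype Z]

/-- A measure `q` on `X × Y × Z` together with `H(X|Y)`, `H(Y|X)` and `H(X|Y,Z)`. -/
noncomputable def entropyVec (q : X × Y × Z → ℝ) : (X × Y × Z → ℝ) × ℝ × ℝ × ℝ :=
  (q, condEntropy q (fun t => t.1) (fun t => t.2.1),
    condEntropy q (fun t => t.2.1) (fun t => t.1),
    condEntropy q (fun t => t.1) (fun t => t.2))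

variable (X Y Z) in
/-- The averages of `entropyVec` over finite auxiliary alphabets. -/
def entropyHull : Set ((X × Y × Z → ℝ) × ℝ × ℝ × ℝ) :=
  convexHull ℝ (entropyVec '' stdSimplex ℝ (X × Y × Z))

theorem continuous_entropyVec : Continuous (entropyVec : (X × Y × Z → ℝ) → _) :=
  continuous_id.prodMk ((continuous_condEntropy _ _).prodMk
    ((continuous_condEntropy _ _).prodMk (continuous_condEntropy _ _)))

theorem isCompact_entropyHull : IsCompact (entropyHull X Y Z) :=
  isCompact_convexHull_of_finiteDimensional
    ((isCompact_stdSimplex ℝ _).image continuous_entropyVec)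

theorem entropyVec_smul (c : ℝ) (q : X × Y × Z → ℝ) :
    entropyVec (fun t => c * q t) = c • entropyVec q := by
  simp only [entropyVec, condEntropy_smul]
  rfl

/-- By homogeneity, the sum is a convex combination of the vectors of the normalized `q j`, weighted
by their masses. -/
theorem sum_entropyVec_mem_entropyHull {J : Type*} [Fintype J] {q : J → X × Y × Z → ℝ}
    (hq : ∀ j t, 0 ≤ q j t) (hsum : ∑ j, ∑ t, q j t = 1) :
    ∑ j, entropyVec (q j) ∈ entropyHull X Y Z := by
  classical
  have hne : Nonempty (X × Y × Z) := by
    by_contra h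
    rw [not_nonempty_iff] at h
    simp at hsum
  obtain ⟨t₀⟩ := hne
  -- A slice of mass zero cannot be normalized; a point mass replaces it and receives weight `0`.
  let q' : J → X × Y × Z → ℝ := fun j =>
    if ∑ t, q j t = 0 then Pi.single t₀ 1 else fun t => (∑ t, q j t)⁻¹ * q j t
  refine mem_convexHull_of_exists_fintype (fun j => ∑ t, q j t) (fun j => entropyVec (q' j))
    (fun j => sum_nonneg fun t _ => hq j t) hsum (fun j => ⟨q' j, ?_, rfl⟩) ?_
  · by_cases h : ∑ t, q j t = 0
    · simp only [q', h, if_true]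
      exact single_mem_stdSimplex ℝ t₀
    · simp only [q', h, if_false]
      refine ⟨fun t => mul_nonneg (inv_nonneg.2 (sum_nonneg fun t _ => hq j t)) (hq j t), ?_⟩
      rw [← mul_sum, inv_mul_cancel₀ h]
  · refine sum_congr rfl fun j _ => ?_
    rw [← entropyVec_smul]
    congr 1
    funext t
    by_cases h : ∑ t, q j t = 0
    · simp [h, (sum_eq_zero_iff_of_nonneg fun t _ => hq j t).1 h t (mem_univ t)]
    · simp only [q', h, if_false]
      rw [mul_inv_cancel_left₀ h]

theorem exists_of_mem_entropyHull {t : (X × Y × Z → ℝ) × ℝ × ℝ × ℝ} (ht : t ∈ entropyHull X Y Z) :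
    ∃ (k : ℕ) (q : Fin k → X × Y × Z → ℝ), (∀ j t, 0 ≤ q j t) ∧ ∑ j, ∑ t, q j t = 1 ∧
      ∑ j, entropyVec (q j) = t := by
  obtain ⟨ι, _, w, z, hw, hw1, hz, rfl⟩ := mem_convexHull_iff_exists_fintype.1 ht
  choose q hq hqz using hz
  let e := (Fintype.equivFin ι).symm
  refine ⟨Fintype.card ι, fun j t => w (e j) * q (e j) t,
    fun j t => mul_nonneg (hw _) ((hq _).1 t), ?_, ?_⟩
  · simp only [← mul_sum, (hq _).2, mul_one]
    rw [← hw1, ← e.sum_comp]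
  · simp only [entropyVec_smul, hqz]
    exact e.sum_comp fun i => w i • z i

/-- The components of an averaged `entropyVec` are the conditional entropies of the joint law. -/
theorem sum_entropyVec_eq {S : Type*} [Fintype S] (Q : S × X × Y × Z → ℝ) :
    ∑ s, entropyVec (fun t => Q (s, t)) =
      (law Q (fun ω => ω.2), condEntropy Q (fun ω => ω.2.1) (fun ω => (ω.1, ω.2.2.1)),
        condEntropy Q (fun ω => ω.2.2.1) (fun ω => (ω.1, ω.2.1)),
        condEntropy Q (fun ω => ω.2.1) (fun ω => (ω.1, ω.2.2))) := by
  have hlaw : ∀ s t, law Q (fun ω => (ω.1, ω.2)) (s, t) = Q (s, t) := fun s t => by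
    exact congrFun (law_id Q) (s, t)
  refine Prod.ext ?_ (Prod.ext ?_ (Prod.ext ?_ ?_)) <;>
    simp only [entropyVec, Prod.fst_sum, Prod.snd_sum]
  · funext t
    rw [← sum_law_prod_left Q (fun ω => ω.1), Finset.sum_apply]
    exact sum_congr rfl fun s _ => (hlaw s t).symm
  · rw [condEntropy_eq_sum Q (fun ω => ω.1) (fun ω => ω.2) (fun t => t.1) (fun t => t.2.1)]
    simp only [hlaw]
  · rw [condEntropy_eq_sum Q (fun ω => ω.1) (fun ω => ω.2) (fun t => t.2.1) (fun t => t.1)]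
    simp only [hlaw]
  · rw [condEntropy_eq_sum Q (fun ω => ω.1) (fun ω => ω.2) (fun t => t.1) (fun t => t.2)]
    simp only [hlaw]

/-- The points of `entropyHull` that satisfy the constraints up to `δ`: the `(X, Y)`-marginal is
`δ`-close to `P` in relative entropy, and the Markov chains `S - X - Y` and `Z - (S, Y) - X` hold
up to a conditional mutual information of `δ`. -/
structure IsFeasiblePoint (P : X × Y → ℝ) (d : X → Z → ℝ) (D δ : ℝ)
    (t : (X × Y × Z → ℝ) × ℝ × ℝ × ℝ) : Prop where
  mem : t ∈ entropyHull X Y Z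
  -- Since `Real.log 0 = 0`, the cross-entropy in `divergence` does not see points where `P`
  -- vanishes, so absolute continuity is a separate condition. With it, `divergence` compares
  -- continuous functions of `t`.
  support : ∀ xy, P xy = 0 → law t.1 (fun v => (v.1, v.2.1)) xy = 0
  divergence : -∑ xy, law t.1 (fun v => (v.1, v.2.1)) xy * Real.log (P xy)
    ≤ (entropy t.1 (fun v => (v.1, v.2.1)) + δ) * Real.log 2
  markov_left : condEntropy t.1 (fun v => v.2.1) (fun v => v.1) - t.2.2.1 ≤ δ
  markov_right : t.2.1 - t.2.2.2 ≤ δ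
  distortion : ∑ v, t.1 v * d v.1 v.2.2 ≤ D

/-- `I(X;S|Y)` as a function of a point of `entropyHull`. -/
noncomputable def pointRate (t : (X × Y × Z → ℝ) × ℝ × ℝ × ℝ) : ℝ :=
  condEntropy t.1 (fun v => v.1) (fun v => v.2.1) - t.2.1

theorem continuous_pointRate :
    Continuous (pointRate : (X × Y × Z → ℝ) × ℝ × ℝ × ℝ → ℝ) :=
  ((continuous_condEntropy _ _).comp continuous_fst).sub (continuous_fst.comp continuous_snd)

/-- All constraints are equalities or weak inequalities between continuous functions of `t` and of
the slack, so the slack may tend to its limit along with the point. -/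
theorem IsFeasiblePoint.of_tendsto {P : X × Y → ℝ} {d : X → Z → ℝ} {D δ : ℝ} {u : ℕ → ℝ}
    {t : ℕ → (X × Y × Z → ℝ) × ℝ × ℝ × ℝ} {t₀ : (X × Y × Z → ℝ) × ℝ × ℝ × ℝ}
    (h : ∀ n, IsFeasiblePoint P d D (u n) (t n)) (hu : Tendsto u atTop (𝓝 δ))
    (ht : Tendsto t atTop (𝓝 t₀)) : IsFeasiblePoint P d D δ t₀ := by
  have h1 : Tendsto (fun n => (t n).1) atTop (𝓝 t₀.1) := (continuous_fst.tendsto _).comp ht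
  have h2 : Tendsto (fun n => (t n).2.1) atTop (𝓝 t₀.2.1) :=
    ((continuous_fst.comp continuous_snd).tendsto _).comp ht
  have h3 : Tendsto (fun n => (t n).2.2.1) atTop (𝓝 t₀.2.2.1) :=
    ((continuous_fst.comp (continuous_snd.comp continuous_snd)).tendsto _).comp ht
  have h4 : Tendsto (fun n => (t n).2.2.2) atTop (𝓝 t₀.2.2.2) :=
    ((continuous_snd.comp (continuous_snd.comp continuous_snd)).tendsto _).comp ht
  have hlaw : ∀ xy, Tendsto (fun n => law (t n).1 (fun v => (v.1, v.2.1)) xy) atTop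
      (𝓝 (law t₀.1 (fun v => (v.1, v.2.1)) xy)) := fun xy =>
    ((continuous_law _ xy).tendsto _).comp h1
  refine ⟨isCompact_entropyHull.isClosed.mem_of_tendsto ht (Eventually.of_forall fun n => (h n).mem),
    fun xy hxy => ?_, ?_, ?_, ?_, ?_⟩
  · refine tendsto_nhds_unique (hlaw xy) ?_
    simp only [(h _).support xy hxy]
    exact tendsto_const_nhds
  · refine le_of_tendsto_of_tendsto' (tendsto_finsetSum _ fun xy _ => (hlaw xy).mul_const _).neg
      (Tendsto.mul_const _ (Tendsto.add ?_ hu)) fun n => (h n).divergence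
    exact ((continuous_entropy _).tendsto _).comp h1
  · refine le_of_tendsto_of_tendsto' (Tendsto.sub ?_ h3) hu fun n => (h n).markov_left
    exact ((continuous_condEntropy _ _).tendsto _).comp h1
  · exact le_of_tendsto_of_tendsto' (h2.sub h4) hu fun n => (h n).markov_right
  · have hsum : Tendsto (fun n => ∑ v, (t n).1 v * d v.1 v.2.2) atTop
        (𝓝 (∑ v, t₀.1 v * d v.1 v.2.2)) :=
      tendsto_finsetSum _ fun v _ => (((continuous_apply v).tendsto _).comp h1).mul_const _
    exact le_of_tendsto' hsum fun n => (h n).distortion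

theorem isCompact_setOf_isFeasiblePoint (P : X × Y → ℝ) (d : X → Z → ℝ) (D δ : ℝ) :
    IsCompact {t | IsFeasiblePoint P d D δ t} := by
  refine isCompact_entropyHull.of_isClosed_subset ?_ fun t ht => ht.mem
  exact IsSeqClosed.isClosed fun t t₀ h ht =>
    IsFeasiblePoint.of_tendsto h tendsto_const_nhds ht

/-! ### Feasible rates as values on the region -/

/-- A joint pmf is determined by its marginals and the two Markov chains. -/
theorem exists_jointPmf_eq {S : Type*} [Fintype S] {P : X × Y → ℝ} {Q : S × X × Y × Z → ℝ}
    (hQ : Q ∈ stdSimplex ℝ (S × X × Y × Z)) (hP : law Q (fun ω => (ω.2.1, ω.2.2.1)) = P)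
    (h₁ : law Q (fun ω => (ω.2.2.1, ω.1, ω.2.1))
      = condProductLaw Q (fun ω => ω.2.2.1) (fun ω => ω.1) (fun ω => ω.2.1))
    (h₂ : law Q (fun ω => (ω.2.1, ω.2.2.2, (ω.1, ω.2.2.1)))
      = condProductLaw Q (fun ω => ω.2.1) (fun ω => ω.2.2.2) (fun ω => (ω.1, ω.2.2.1))) :
    ∃ (W : X → S → ℝ) (V : S → Y → Z → ℝ), (∀ x, W x ∈ stdSimplex ℝ S) ∧
      (∀ s y, V s y ∈ stdSimplex ℝ Z) ∧ jointPmf P W V = Q := by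
  classical
  have hne : Nonempty (S × X × Y × Z) := by
    by_contra h
    rw [not_nonempty_iff] at h
    simpa using hQ.2
  obtain ⟨s₀, -, -, z₀⟩ := hne
  let LX := law Q fun ω => ω.2.1
  let LSX := law Q fun ω => (ω.1, ω.2.1)
  let LSY := law Q fun ω => (ω.1, ω.2.2.1)
  let LZSY := law Q fun ω => (ω.2.2.2, (ω.1, ω.2.2.1))
  -- Conditional pmfs are read off from the marginals. On null events an arbitrary point mass is
  -- used, and the factor multiplying it is zero.
  let W : X → S → ℝ := fun x => if LX x = 0 then Pi.single s₀ 1 else fun s => LSX (s, x) / LX x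
  let V : S → Y → Z → ℝ := fun s y =>
    if LSY (s, y) = 0 then Pi.single z₀ 1 else fun z => LZSY (z, (s, y)) / LSY (s, y)
  refine ⟨W, V, fun x => ?_, fun s y => ?_, ?_⟩
  · by_cases h : LX x = 0
    · simp only [W, h, if_true]
      exact single_mem_stdSimplex ℝ s₀
    · simp only [W, h, if_false]
      refine ⟨fun s => div_nonneg (law_nonneg hQ.1 _ _) (law_nonneg hQ.1 _ _), ?_⟩
      rw [← sum_div]
      exact (div_eq_one_iff_eq h).2 (sum_law_prod_left Q _ _ x)
  · by_cases h : LSY (s, y) = 0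
    · simp only [V, h, if_true]
      exact single_mem_stdSimplex ℝ z₀
    · simp only [V, h, if_false]
      refine ⟨fun s => div_nonneg (law_nonneg hQ.1 _ _) (law_nonneg hQ.1 _ _), ?_⟩
      rw [← sum_div]
      exact (div_eq_one_iff_eq h).2 (sum_law_prod_left Q _ _ (s, y))
  · funext ⟨s, x, y, z⟩
    have hSXY : W x s * P (x, y) = law Q (fun ω => (ω.2.1, (ω.1, ω.2.2.1))) (x, (s, y)) := by
      have e1 : law Q (fun ω => (ω.2.1, (ω.1, ω.2.2.1))) (x, (s, y))
          = law Q (fun ω => (ω.2.2.1, ω.1, ω.2.1)) (y, s, x) :=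
        law_eq_law Q fun ω => by simp only [Prod.mk.injEq]; tauto
      have e2 : law Q (fun ω => (ω.2.2.1, ω.2.1)) (y, x) = P (x, y) := by
        rw [← hP]
        exact law_eq_law Q fun ω => by simp only [Prod.mk.injEq]; tauto
      rw [e1, h₁]
      simp only [condProductLaw]
      rw [e2]
      by_cases h : LX x = 0
      · have : P (x, y) = 0 := by
          rw [← e2]
          exact law_eq_zero_of_imp hQ.1 (fun ω hω => by simp_all) h
        simp [this]
      · simp only [W, h, if_false]
        simp only [LSX, LX]
        ring
    have hQ4 : Q (s, x, y, z)
        = law Q (fun ω => (ω.2.1, ω.2.2.2, (ω.1, ω.2.2.1))) (x, z, (s, y)) := by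
      conv_lhs => rw [← law_id Q]
      exact law_eq_law Q fun ω => by
        obtain ⟨a, b, c, e⟩ := ω
        simp only [Prod.mk.injEq]; tauto
    rw [hQ4, h₂]
    simp only [jointPmf, condProductLaw]
    rw [hSXY]
    by_cases h : LSY (s, y) = 0
    · have : law Q (fun ω => (ω.2.1, (ω.1, ω.2.2.1))) (x, (s, y)) = 0 :=
        law_eq_zero_of_imp hQ.1 (fun ω hω => by simp_all) h
      simp [this]
    · simp only [V, h, if_false]
      simp only [LZSY, LSY]
      ring

theorem law_jointPmf_source {S : Type*} [Fintype S] (P : X × Y → ℝ) {W : X → S → ℝ}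
    {V : S → Y → Z → ℝ} (hW : ∀ x, W x ∈ stdSimplex ℝ S) (hV : ∀ s y, V s y ∈ stdSimplex ℝ Z) :
    law (jointPmf P W V) (fun ω => (ω.2.1, ω.2.2.1)) = P := by
  classical
  funext ⟨x, y⟩
  simp only [law, Fintype.sum_prod_type, Prod.mk.injEq, jointPmf, ite_and]
  simp [← mul_sum, (hV _ _).2, ← sum_mul, (hW _).2]

/-- Given `x`, the law splits into a factor in `y` and a factor in `s`, which is the chain `S - X -
Y`. -/
theorem law_jointPmf_auxiliary {S : Type*} [Fintype S] (P : X × Y → ℝ) (W : X → S → ℝ)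
    {V : S → Y → Z → ℝ} (hV : ∀ s y, V s y ∈ stdSimplex ℝ Z) (y : Y) (s : S) (x : X) :
    law (jointPmf P W V) (fun ω => (ω.2.2.1, ω.1, ω.2.1)) (y, s, x) = P (x, y) * W x s := by
  classical
  simp only [law, Fintype.sum_prod_type, Prod.mk.injEq, jointPmf, ite_and]
  simp [← mul_sum, (hV _ _).2]
  exact mul_comm _ _

theorem jointPmf_mem_stdSimplex {S : Type*} [Fintype S] {P : X × Y → ℝ}
    (hP : P ∈ stdSimplex ℝ (X × Y)) {W : X → S → ℝ}
    {V : S → Y → Z → ℝ} (hW : ∀ x, W x ∈ stdSimplex ℝ S) (hV : ∀ s y, V s y ∈ stdSimplex ℝ Z) :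
    jointPmf P W V ∈ stdSimplex ℝ (S × X × Y × Z) := by
  refine ⟨fun ω => mul_nonneg (mul_nonneg ((hW _).1 _) (hP.1 _)) ((hV _ _).1 _), ?_⟩
  rw [← sum_law _ (fun ω : S × X × Y × Z => (ω.2.1, ω.2.2.1)), law_jointPmf_source P hW hV, hP.2]

theorem entropy_source_eq {P : X × Y → ℝ} {A : Type*} [Fintype A] {q : A → ℝ} {f : A → X × Y}
    (h : law q f = P) : entropy q f * Real.log 2 = -∑ xy, P xy * Real.log (P xy) := by
  rw [entropy_mul_log_two, h]

/-- The feasible rates are the values of `pointRate` on the exactly feasible points. -/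
theorem feasibleRates_eq_image {P : X × Y → ℝ} (hP : P ∈ stdSimplex ℝ (X × Y)) (d : X → Z → ℝ)
    (D : ℝ) : feasibleRates P d D = pointRate '' {t | IsFeasiblePoint P d D 0 t} := by
  ext r
  constructor
  · rintro ⟨k, W, V, hW, hV, hD, rfl⟩
    have hQ := jointPmf_mem_stdSimplex hP hW hV
    set Q := jointPmf P W V with hQdef
    have hsrc : law (law Q fun ω => ω.2) (fun v => (v.1, v.2.1)) = P := by
      rw [← law_jointPmf_source P hW hV]
      funext xy
      exact law_law _ _ _ _
    refine ⟨∑ s, entropyVec (fun t => Q (s, t)), ⟨?_, ?_, ?_, ?_, ?_, ?_⟩, ?_⟩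
    · refine sum_entropyVec_mem_entropyHull (fun s t => hQ.1 _) ?_
      rw [← hQ.2, Fintype.sum_prod_type]
    all_goals rw [sum_entropyVec_eq]
    · intro xy hxy
      dsimp only
      rw [hsrc, hxy]
    · dsimp only
      rw [add_zero, entropy_source_eq hsrc, hsrc]
    · dsimp only
      rw [sub_nonpos, condEntropy, condEntropy, entropy_law, entropy_law]
      have := entropy_add_eq_of_law_eq hQ.1 (law_eq_condProductLaw_of_factor hQ.1
        (f := fun ω => ω.2.2.1) (g := fun ω => ω.1) (h := fun ω => ω.2.1)
        (fun y x => P (x, y)) (fun s x => W x s) fun y s x => law_jointPmf_auxiliary P W hV y s x)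
      linarith
    · dsimp only
      rw [sub_nonpos, condEntropy, condEntropy]
      have hfac := law_eq_condProductLaw_of_factor hQ.1
        (f := fun ω => ω.2.1) (g := fun ω => ω.2.2.2) (h := fun ω => (ω.1, ω.2.2.1))
        (fun x sy => W x sy.1 * P (x, sy.2)) (fun z sy => V sy.1 sy.2 z) (by
          rintro x z ⟨s, y⟩
          have : law Q (fun ω => (ω.2.1, ω.2.2.2, (ω.1, ω.2.2.1))) (x, z, (s, y))
              = Q (s, x, y, z) := by
            conv_rhs => rw [← law_id Q]
            exact law_eq_law Q fun ω => by
              obtain ⟨a, b, c, e⟩ := ω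
              simp only [Prod.mk.injEq]; tauto
          rw [this]
          rfl)
      have := entropy_add_eq_of_law_eq hQ.1 hfac
      rw [entropy_congr Q (f := fun ω => (ω.2.2.2, (ω.1, ω.2.2.1))) (g := fun ω => (ω.1, ω.2.2)),
        entropy_congr Q (f := fun ω => (ω.2.1, ω.2.2.2, (ω.1, ω.2.2.1)))
          (g := fun ω => (ω.2.1, (ω.1, ω.2.2)))] at this
      · linarith
      all_goals
        rintro ⟨a, b, c, e⟩ ⟨a', b', c', e'⟩
        simp only [Prod.mk.injEq]; tauto
    · dsimp only
      rw [sum_law_mul Q (fun ω => ω.2) fun v => d v.1 v.2.2]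
      exact hD
    · simp only [pointRate, condMutualInfo, condEntropy, entropy_law]
  · rintro ⟨t, ht, rfl⟩
    obtain ⟨k, q, hq, hq1, rfl⟩ := exists_of_mem_entropyHull ht.mem
    let Q : Fin k × X × Y × Z → ℝ := fun ω => q ω.1 ω.2
    have hQ : Q ∈ stdSimplex ℝ (Fin k × X × Y × Z) :=
      ⟨fun ω => hq _ _, by rw [← hq1, Fintype.sum_prod_type]⟩
    have hvec := sum_entropyVec_eq Q
    change ∑ s, entropyVec (q s) = _ at hvec
    obtain ⟨-, hs, hdiv, hl, hr, hD⟩ := ht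
    rw [hvec] at hs hdiv hl hr hD ⊢
    dsimp only at hs hdiv hl hr hD
    have hsrc : law Q (fun ω => (ω.2.1, ω.2.2.1)) = P := by
      have hlaw : law (law Q fun ω => ω.2) (fun v => (v.1, v.2.1))
          = law Q (fun ω => (ω.2.1, ω.2.2.1)) := funext fun xy => law_law _ _ _ _
      rw [add_zero, entropy_mul_log_two, hlaw] at hdiv
      rw [hlaw] at hs
      -- With slack `0` the relative entropy of the source marginal with respect to `P` vanishes,
      -- hence the two agree.
      refine eq_of_sum_mul_log_le (law_nonneg hQ.1 _) hP.1 hs ?_ (by linarith)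
      rw [sum_law, hQ.2, hP.2]
    rw [sub_nonpos, condEntropy, condEntropy, entropy_law, entropy_law] at hl
    rw [sub_nonpos, condEntropy, condEntropy] at hr
    obtain ⟨W, V, hW, hV, hWV⟩ := exists_jointPmf_eq hQ hsrc
      (law_eq_condProductLaw hQ.1 (by linarith)) (law_eq_condProductLaw hQ.1 (by
        rw [entropy_congr Q (f := fun ω => (ω.2.2.2, (ω.1, ω.2.2.1)))
            (g := fun ω => (ω.1, ω.2.2)),
          entropy_congr Q (f := fun ω => (ω.2.1, ω.2.2.2, (ω.1, ω.2.2.1)))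
            (g := fun ω => (ω.2.1, (ω.1, ω.2.2)))]
        · linarith
        all_goals
          rintro ⟨a, b, c, e⟩ ⟨a', b', c', e'⟩
          simp only [Prod.mk.injEq]; tauto))
    refine ⟨k, W, V, hW, hV, ?_, ?_⟩
    · rw [hWV]
      rw [sum_law_mul Q (fun ω => ω.2) fun v => d v.1 v.2.2] at hD
      exact hD
    · rw [hWV]
      simp only [pointRate, condMutualInfo, condEntropy, entropy_law]

theorem isCompact_feasibleRates {P : X × Y → ℝ} (hP : P ∈ stdSimplex ℝ (X × Y)) (d : X → Z → ℝ)
    (D : ℝ) : IsCompact (feasibleRates P d D) := by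
  rw [feasibleRates_eq_image hP]
  exact (isCompact_setOf_isFeasiblePoint P d D 0).image continuous_pointRate

/-- Asymptotically feasible points of asymptotic rate at most `R` yield a feasible rate `≤ R`. -/
theorem exists_feasibleRate_le {P : X × Y → ℝ} (hP : P ∈ stdSimplex ℝ (X × Y)) {d : X → Z → ℝ}
    {D R : ℝ} {u v : ℕ → ℝ} (hu : Tendsto u atTop (𝓝 0)) (hv : Tendsto v atTop (𝓝 0))
    {t : ℕ → (X × Y × Z → ℝ) × ℝ × ℝ × ℝ}
    (ht : ∀ n, IsFeasiblePoint P d D (u n) (t n)) (hR : ∀ n, pointRate (t n) ≤ R + v n) :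
    ∃ r ∈ feasibleRates P d D, r ≤ R := by
  obtain ⟨t₀, -, ψ, hψ, hlim⟩ := isCompact_entropyHull.tendsto_subseq fun n => (ht n).mem
  have hu' := hu.comp hψ.tendsto_atTop
  refine ⟨pointRate t₀, ?_, ?_⟩
  · rw [feasibleRates_eq_image hP]
    exact ⟨t₀, IsFeasiblePoint.of_tendsto (fun n => ht (ψ n)) hu' hlim, rfl⟩
  · refine le_of_tendsto_of_tendsto' ((continuous_pointRate.tendsto _).comp hlim)
      (b := atTop) (g := fun n => R + v (ψ n)) ?_ fun n => hR (ψ n)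
    simpa using (hv.comp hψ.tendsto_atTop).const_add R

end Region

/-! ### Time sharing -/

section TimeShare

variable {Ω A B C : Type*} [Fintype Ω] [Fintype A] [Fintype B] [Fintype C] {n : ℕ}

/-- The pmf of `(T, ω)` with `T` uniform on `Fin n` and independent of `ω`. -/
noncomputable def timeShare (n : ℕ) (p : Ω → ℝ) : Fin n × Ω → ℝ := fun v => (n : ℝ)⁻¹ * p v.2

theorem sum_timeShare_mul (p : Ω → ℝ) (F : Fin n × Ω → ℝ) :
    ∑ v, timeShare n p v * F v = (n : ℝ)⁻¹ * ∑ ω, p ω * ∑ i, F (i, ω) := by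
  rw [Fintype.sum_prod_type, sum_comm, mul_sum]
  refine sum_congr rfl fun ω _ => ?_
  simp only [timeShare, mul_sum, mul_assoc]

theorem timeShare_mem_stdSimplex (hn : n ≠ 0) {p : Ω → ℝ} (hp : p ∈ stdSimplex ℝ Ω) :
    timeShare n p ∈ stdSimplex ℝ (Fin n × Ω) := by
  refine ⟨fun v => mul_nonneg (by positivity) (hp.1 _), ?_⟩
  have h := sum_timeShare_mul (n := n) p fun _ => 1
  have hn' : (n : ℝ) ≠ 0 := by exact_mod_cast hn
  simpa [← sum_mul, hp.2, hn'] using h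

theorem law_timeShare {A : Type*} (p : Ω → ℝ) (f : Fin n → Ω → A) (a : A) :
    law (timeShare n p) (fun v => f v.1 v.2) a = (n : ℝ)⁻¹ * ∑ i, law p (f i) a := by
  classical
  simp only [law, timeShare, Fintype.sum_prod_type, mul_sum, mul_ite, mul_zero]

theorem entropy_timeShare_prod (p : Ω → ℝ) (f : Fin n → Ω → A) :
    entropy (timeShare n p) (fun v => (v.1, f v.1 v.2))
      = ∑ i, entropy (fun ω => (n : ℝ)⁻¹ * p ω) (f i) := by
  classical
  simp only [entropy, ← sum_div, Fintype.sum_prod_type]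
  congr 1
  refine sum_congr rfl fun i _ => sum_congr rfl fun a _ => ?_
  congr 1
  conv_lhs => unfold law
  rw [Fintype.sum_prod_type, sum_eq_single i]
  · simp [law, timeShare]
  · intro j _ hj
    simp [hj]
  · simp

/-- Conditioning on the uniform time index turns a single conditional entropy into the average over
the coordinates. -/
theorem condEntropy_timeShare (p : Ω → ℝ) (f : Fin n → Ω → A) (u : Fin n → Ω → B)
    (h : Fin n → Ω → C) :
    condEntropy (timeShare n p) (fun v => f v.1 v.2) (fun v => ((v.1, u v.1 v.2), h v.1 v.2))
      = (n : ℝ)⁻¹ * ∑ i, condEntropy p (f i) (fun ω => (u i ω, h i ω)) := by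
  simp only [mul_sum, ← condEntropy_smul]
  simp only [condEntropy, sum_sub_distrib]
  rw [← entropy_timeShare_prod p (fun i ω => (u i ω, h i ω)),
    ← entropy_timeShare_prod p (fun i ω => (f i ω, u i ω, h i ω))]
  congr 1 <;> refine entropy_congr _ fun v w => ?_ <;> simp only [Prod.mk.injEq] <;> tauto

theorem entropy_pi_le_timeShare (hn : n ≠ 0) {p : Ω → ℝ} (hp : p ∈ stdSimplex ℝ Ω)
    (f : Fin n → Ω → A) :
    entropy p (fun ω i => f i ω) ≤ n * entropy (timeShare n p) (fun v => f v.1 v.2) := by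
  rw [← entropy_law (timeShare n p) (fun v => f v.1 v.2) fun a => a]
  refine entropy_pi_le hp f _ fun a => ?_
  have hn' : (n : ℝ) ≠ 0 := by exact_mod_cast hn
  rw [law_timeShare, mul_inv_cancel_left₀ hn']

end TimeShare

/-! ### Single-letterization under an arbitrary law -/

section Blocks

variable {X Y M : Type*} {n : ℕ}

/-- The first `i` entries of `X^n`. -/
def xBefore (i : ℕ) (ω : Fin n → X × Y) (j : Fin n) : Option X :=
  if j.val < i then some (ω j).1 else none

/-- The entries of `Y^n` from the index `i` on. -/
def yFrom (i : ℕ) (ω : Fin n → X × Y) (j : Fin n) : Option Y :=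
  if i ≤ j.val then some (ω j).2 else none

theorem xBefore_eq_iff {i : ℕ} {ω ω' : Fin n → X × Y} :
    xBefore i ω = xBefore i ω' ↔ ∀ j : Fin n, j.val < i → (ω j).1 = (ω' j).1 := by
  simp only [funext_iff, xBefore]
  refine forall_congr' fun j => ?_
  by_cases h : j.val < i <;> simp [h]

theorem yFrom_eq_iff {i : ℕ} {ω ω' : Fin n → X × Y} :
    yFrom i ω = yFrom i ω' ↔ ∀ j : Fin n, i ≤ j.val → (ω j).2 = (ω' j).2 := by
  simp only [funext_iff, yFrom]
  refine forall_congr' fun j => ?_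
  by_cases h : i ≤ j.val <;> simp [h]

theorem xBefore_succ_eq_iff {i : Fin n} {ω ω' : Fin n → X × Y} :
    xBefore (i + 1) ω = xBefore (i + 1) ω' ↔
      xBefore i ω = xBefore i ω' ∧ (ω i).1 = (ω' i).1 := by
  simp only [xBefore_eq_iff]
  refine ⟨fun h => ⟨fun j hj => h j (by omega), h i (by omega)⟩, fun h j hj => ?_⟩
  rcases Nat.lt_succ_iff_lt_or_eq.1 hj with hj | hj
  · exact h.1 j hj
  · rw [Fin.ext hj]; exact h.2

theorem yFrom_eq_iff_succ {i : Fin n} {ω ω' : Fin n → X × Y} :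
    yFrom i ω = yFrom i ω' ↔ yFrom (i + 1) ω = yFrom (i + 1) ω' ∧ (ω i).2 = (ω' i).2 := by
  simp only [yFrom_eq_iff]
  refine ⟨fun h => ⟨fun j hj => h j (by omega), h i le_rfl⟩, fun h j hj => ?_⟩
  rcases hj.eq_or_lt with hj | hj
  · rw [← Fin.ext hj]; exact h.2
  · exact h.1 j hj

theorem xs_eq_iff {ω ω' : Fin n → X × Y} :
    (fun j => (ω j).1) = (fun j => (ω' j).1) ↔ ∀ j, (ω j).1 = (ω' j).1 := funext_iff

theorem ys_eq_iff {ω ω' : Fin n → X × Y} :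
    (fun j => (ω j).2) = (fun j => (ω' j).2) ↔ ∀ j, (ω j).2 = (ω' j).2 := funext_iff

/-- The auxiliary random variable `(M, X_1, …, X_{i-1}, Y_{i+1}, …, Y_n)`. -/
def auxiliary (φ : (Fin n → X) → M) (i : Fin n) (ω : Fin n → X × Y) :
    M × (Fin n → Option X) × (Fin n → Option Y) :=
  (φ fun j => (ω j).1, xBefore i ω, yFrom (i + 1) ω)

end Blocks

section SingleLetter

variable {X Y Z M : Type*} [Fintype X] [Fintype Y] [Fintype Z] [Fintype M] {n : ℕ}
  {p : (Fin n → X × Y) → ℝ} (φ : (Fin n → X) → M)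

/-- A Csiszár-type sum identity: `(U_i, Y_i)` is equivalent to `(M, X^{i-1}, Y_i^n)` and `(U_i,
X_i)` to `(M, X^i, Y_{i+1}^n)`, so the joint entropies cancel and the rest telescopes. At the upper
end `M` is absorbed because it is a function of `X^n`. -/
theorem sum_condEntropy_X_sub_sum_condEntropy_Y :
    ∑ i, condEntropy p (fun ω => (ω i).1) (fun ω => (auxiliary φ i ω, (ω i).2))
      - ∑ i, condEntropy p (fun ω => (ω i).2) (fun ω => (auxiliary φ i ω, (ω i).1))
      = entropy p (fun ω j => (ω j).1)
        - entropy p (fun ω => (φ fun j => (ω j).1, fun j => (ω j).2)) := by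
  let F : ℕ → ℝ := fun i => entropy p fun ω => (φ fun j => (ω j).1, xBefore i ω, yFrom i ω)
  have hstep : ∀ i : Fin n,
      condEntropy p (fun ω => (ω i).1) (fun ω => (auxiliary φ i ω, (ω i).2))
        - condEntropy p (fun ω => (ω i).2) (fun ω => (auxiliary φ i ω, (ω i).1))
        = F (i + 1) - F i := fun i => by
    have e1 : entropy p (fun ω => (auxiliary φ i ω, (ω i).2)) = F i :=
      entropy_congr p fun ω ω' => by
        simp only [auxiliary, Prod.mk.injEq, yFrom_eq_iff_succ]; tauto
    have e2 : entropy p (fun ω => (auxiliary φ i ω, (ω i).1)) = F (i + 1) :=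
      entropy_congr p fun ω ω' => by
        simp only [auxiliary, Prod.mk.injEq, xBefore_succ_eq_iff]; tauto
    have e3 : entropy p (fun ω => ((ω i).1, (auxiliary φ i ω, (ω i).2)))
        = entropy p (fun ω => ((ω i).2, (auxiliary φ i ω, (ω i).1))) :=
      entropy_congr p fun ω ω' => by
        simp only [Prod.mk.injEq]; tauto
    simp only [condEntropy]
    rw [e1, e2, e3]
    ring
  rw [← sum_sub_distrib, sum_congr rfl fun i _ => hstep i,
    Fin.sum_univ_eq_sum_range (fun i => F (i + 1) - F i) n, sum_range_sub]
  congr 1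
  · refine entropy_congr p fun ω ω' => ?_
    simp only [Prod.mk.injEq, xBefore_eq_iff, yFrom_eq_iff, xs_eq_iff]
    refine ⟨fun h j => h.2.1 j j.2, fun h => ⟨?_, fun j _ => h j, fun j hj => absurd j.2 (by omega)⟩⟩
    rw [funext h]
  · refine entropy_congr p fun ω ω' => ?_
    simp only [Prod.mk.injEq, xBefore_eq_iff, yFrom_eq_iff, ys_eq_iff]
    simp

/-- The chain rule for `H(Y^n | X^n)`, taken from the last index down: `(U_i, X_i)` is a function of
`(X^n, Y_{i+1}^n)`, so conditioning on it alone leaves more entropy. -/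
theorem le_sum_condEntropy_Y (hp : ∀ ω, 0 ≤ p ω) :
    entropy p (fun ω => ω) - entropy p (fun ω j => (ω j).1)
      ≤ ∑ i, condEntropy p (fun ω => (ω i).2) (fun ω => (auxiliary φ i ω, (ω i).1)) := by
  let K : ℕ → ℝ := fun i => entropy p fun ω => ((fun j => (ω j).1), yFrom i ω)
  have hstep : ∀ i : Fin n, K i - K (i + 1)
      ≤ condEntropy p (fun ω => (ω i).2) (fun ω => (auxiliary φ i ω, (ω i).1)) := fun i => by
    refine le_trans (le_of_eq ?_) (condEntropy_anti hp (fun ω => (ω i).2)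
      (g := fun ω => ((fun j => (ω j).1), yFrom (i + 1) ω)) fun ω ω' h => ?_)
    · simp only [condEntropy, K]
      congr 1
      exact entropy_congr p fun ω ω' => by
        simp only [Prod.mk.injEq, yFrom_eq_iff_succ]; tauto
    · simp only [Prod.mk.injEq] at h
      simp only [auxiliary, Prod.mk.injEq, h.1, h.2, true_and, and_true, xBefore_eq_iff]
      exact ⟨fun j _ => congrFun h.1 j, congrFun h.1 i⟩
  refine le_trans (le_of_eq ?_) (sum_le_sum fun i _ => hstep i)
  rw [Fin.sum_univ_eq_sum_range (fun i => K i - K (i + 1)) n, sum_range_sub']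
  congr 1
  · refine entropy_congr p fun ω ω' => ?_
    simp only [Prod.mk.injEq, yFrom_eq_iff, xs_eq_iff]
    refine ⟨fun h => by simp [h], fun h => funext fun j => Prod.ext (h.1 j) (h.2 j (Nat.zero_le _))⟩
  · refine entropy_congr p fun ω ω' => ?_
    simp only [Prod.mk.injEq, yFrom_eq_iff]
    exact ⟨fun h => ⟨h, fun j hj => absurd j.2 (by omega)⟩, fun h => h.1⟩

/-- The chain rule for `H(X^n | M, Y^n)`. Since `Z_i` is decoded from `(M, Y^n)`, all of `(U_i, Y_i,
Z_i)` is a function of `(M, X^{i-1}, Y^n)`. -/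
theorem le_sum_condEntropy_X (hp : ∀ ω, 0 ≤ p ω) (g : M → (Fin n → Y) → (Fin n → Z)) :
    entropy p (fun ω => ω) - entropy p (fun ω => (φ fun j => (ω j).1, fun j => (ω j).2))
      ≤ ∑ i, condEntropy p (fun ω => (ω i).1) (fun ω => (auxiliary φ i ω,
          ((ω i).2, g (φ fun j => (ω j).1) (fun j => (ω j).2) i))) := by
  let J : ℕ → ℝ := fun i => entropy p fun ω =>
    (φ fun j => (ω j).1, xBefore i ω, fun j => (ω j).2)
  have hstep : ∀ i : Fin n, J (i + 1) - J i
      ≤ condEntropy p (fun ω => (ω i).1) (fun ω => (auxiliary φ i ω,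
          ((ω i).2, g (φ fun j => (ω j).1) (fun j => (ω j).2) i))) := fun i => by
    refine le_trans (le_of_eq ?_) (condEntropy_anti hp (fun ω => (ω i).1)
      (g := fun ω => (φ fun j => (ω j).1, xBefore i ω, fun j => (ω j).2)) fun ω ω' h => ?_)
    · simp only [condEntropy, J]
      congr 1
      exact entropy_congr p fun ω ω' => by
        simp only [Prod.mk.injEq, xBefore_succ_eq_iff]; tauto
    · simp only [Prod.mk.injEq] at h
      simp only [auxiliary, Prod.mk.injEq, h.1, h.2.1, h.2.2, true_and, and_true, yFrom_eq_iff]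
      exact ⟨fun j _ => congrFun h.2.2 j, congrFun h.2.2 i⟩
  refine le_trans (le_of_eq ?_) (sum_le_sum fun i _ => hstep i)
  rw [Fin.sum_univ_eq_sum_range (fun i => J (i + 1) - J i) n, sum_range_sub]
  congr 1
  · refine entropy_congr p fun ω ω' => ?_
    simp only [Prod.mk.injEq, xBefore_eq_iff, ys_eq_iff]
    exact ⟨fun h => by simp [h],
      fun h => funext fun j => Prod.ext (h.2.1 j j.2) (h.2.2 j)⟩
  · refine entropy_congr p fun ω ω' => ?_
    simp only [Prod.mk.injEq, xBefore_eq_iff]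
    simp

/-- The triple `(X_T, Y_T, Z_T)` with the auxiliary random variable `(T, U_T)`. -/
noncomputable def singleLetterLaw (p : (Fin n → X × Y) → ℝ) (φ : (Fin n → X) → M)
    (g : M → (Fin n → Y) → (Fin n → Z)) :
    (Fin n × M × (Fin n → Option X) × (Fin n → Option Y)) × X × Y × Z → ℝ :=
  law (timeShare n p) fun v => ((v.1, auxiliary φ v.1 v.2), (v.2 v.1).1, (v.2 v.1).2,
    g (φ fun j => (v.2 j).1) (fun j => (v.2 j).2) v.1)

/-- The point of the entropy region belonging to a code used under the law `p`. -/
noncomputable def singleLetterPoint (p : (Fin n → X × Y) → ℝ) (φ : (Fin n → X) → M)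
    (g : M → (Fin n → Y) → (Fin n → Z)) :
    (X × Y × Z → ℝ) × ℝ × ℝ × ℝ :=
  ∑ s, entropyVec fun t => singleLetterLaw p φ g (s, t)

theorem singleLetterPoint_eq (g : M → (Fin n → Y) → (Fin n → Z)) :
    singleLetterPoint p φ g =
      (law (timeShare n p) (fun v => ((v.2 v.1).1, (v.2 v.1).2,
          g (φ fun j => (v.2 j).1) (fun j => (v.2 j).2) v.1)),
        (n : ℝ)⁻¹ * ∑ i, condEntropy p (fun ω => (ω i).1) (fun ω => (auxiliary φ i ω, (ω i).2)),
        (n : ℝ)⁻¹ * ∑ i, condEntropy p (fun ω => (ω i).2) (fun ω => (auxiliary φ i ω, (ω i).1)),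
        (n : ℝ)⁻¹ * ∑ i, condEntropy p (fun ω => (ω i).1) (fun ω => (auxiliary φ i ω,
          ((ω i).2, g (φ fun j => (ω j).1) (fun j => (ω j).2) i)))) := by
  rw [singleLetterPoint, sum_entropyVec_eq, singleLetterLaw]
  refine Prod.ext (funext fun t => law_law _ _ _ _) (Prod.ext ?_ (Prod.ext ?_ ?_))
  · dsimp only
    rw [← condEntropy_timeShare p (fun i ω => (ω i).1) (auxiliary φ) (fun i ω => (ω i).2)]
    simp only [condEntropy, entropy_law]
  · dsimp only
    rw [← condEntropy_timeShare p (fun i ω => (ω i).2) (auxiliary φ) (fun i ω => (ω i).1)]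
    simp only [condEntropy, entropy_law]
  · dsimp only
    rw [← condEntropy_timeShare p (fun i ω => (ω i).1) (auxiliary φ) (fun i ω => ((ω i).2,
      g (φ fun j => (ω j).1) (fun j => (ω j).2) i))]
    simp only [condEntropy, entropy_law]

theorem singleLetterPoint_mem (hn : n ≠ 0) (hp : p ∈ stdSimplex ℝ (Fin n → X × Y))
    (g : M → (Fin n → Y) → (Fin n → Z)) : singleLetterPoint p φ g ∈ entropyHull X Y Z := by
  have hp' := timeShare_mem_stdSimplex hn hp
  refine sum_entropyVec_mem_entropyHull (fun s t => law_nonneg hp'.1 _ _) ?_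
  rw [← Fintype.sum_prod_type, singleLetterLaw, sum_law, hp'.2]

/-- Combine `n H(X_T, Y_T) ≤ H(X^n, Y^n) + β` with `n H(X_T) ≥ H(X^n)` and the lower bound `H(Y^n |
X^n)` for the averaged term. -/
theorem singleLetterPoint_markov_left
    {β : ℝ} (hn : n ≠ 0) (hp : p ∈ stdSimplex ℝ (Fin n → X × Y)) (g : M → (Fin n → Y) → (Fin n → Z))
    (hβ : n * entropy (timeShare n p) (fun v => v.2 v.1) ≤ entropy p (fun ω => ω) + β) :
    condEntropy (singleLetterPoint p φ g).1 (fun v => v.2.1) (fun v => v.1)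
      - (singleLetterPoint p φ g).2.2.1 ≤ β / n := by
  have hn' : (0 : ℝ) < n := by exact_mod_cast Nat.pos_of_ne_zero hn
  rw [singleLetterPoint_eq]
  simp only [condEntropy, entropy_law]
  have hX := entropy_pi_le_timeShare hn hp fun i ω => (ω i).1
  have hB := le_sum_condEntropy_Y φ hp.1
  rw [entropy_congr (timeShare n p) (g := fun v => v.2 v.1) fun v w => by
    rw [Prod.ext_iff, Prod.mk.injEq]; tauto, le_div_iff₀ hn']
  simp only [condEntropy] at hB
  have e : ∀ b c e : ℝ, (b - c - (n : ℝ)⁻¹ * e) * n = n * b - n * c - e := fun b c e => by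
    field_simp
  rw [e]
  linarith

/-- The telescoping identity trades `∑ H(X_i | U_i, Y_i)` for `∑ H(Y_i | U_i, X_i)`, which is at
most `n H(Y_T | X_T)`. The term `H(M, Y^n)` then cancels against the bound of
`le_sum_condEntropy_X`. -/
theorem singleLetterPoint_markov_right
    {β : ℝ} (hn : n ≠ 0) (hp : p ∈ stdSimplex ℝ (Fin n → X × Y)) (g : M → (Fin n → Y) → (Fin n → Z))
    (hβ : n * entropy (timeShare n p) (fun v => v.2 v.1) ≤ entropy p (fun ω => ω) + β) :
    (singleLetterPoint p φ g).2.1 - (singleLetterPoint p φ g).2.2.2 ≤ β / n := by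
  have hn' : (0 : ℝ) < n := by exact_mod_cast Nat.pos_of_ne_zero hn
  have hp' := timeShare_mem_stdSimplex hn hp
  rw [singleLetterPoint_eq]
  dsimp only
  have hX := entropy_pi_le_timeShare hn hp fun i ω => (ω i).1
  have hC := le_sum_condEntropy_X φ hp.1 g
  have hAB := sum_condEntropy_X_sub_sum_condEntropy_Y (p := p) φ
  have hB : (n : ℝ)⁻¹ * ∑ i, condEntropy p (fun ω => (ω i).2)
      (fun ω => (auxiliary φ i ω, (ω i).1)) ≤ condEntropy (timeShare n p)
        (fun v => (v.2 v.1).2) (fun v => (v.2 v.1).1) := by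
    rw [← condEntropy_timeShare p (fun i ω => (ω i).2) (auxiliary φ) (fun i ω => (ω i).1)]
    exact condEntropy_anti hp'.1 _ fun v w h => (Prod.ext_iff.1 h).2
  rw [inv_mul_le_iff₀ hn', condEntropy, entropy_congr (timeShare n p)
    (f := fun v => ((v.2 v.1).2, (v.2 v.1).1)) (g := fun v => v.2 v.1) fun v w => by
    rw [Prod.ext_iff, Prod.mk.injEq]; tauto, mul_sub] at hB
  rw [le_div_iff₀ hn', ← mul_sub, mul_comm, mul_inv_cancel_left₀ hn'.ne']
  linarith

/-- After the telescoping identity, what remains is `H(M, Y^n) - H(Y^n) + β`, and the difference is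
at most `H(M) ≤ log |M|`. -/
theorem pointRate_singleLetterPoint_le
    {β : ℝ} (hn : n ≠ 0) (hp : p ∈ stdSimplex ℝ (Fin n → X × Y)) (g : M → (Fin n → Y) → (Fin n → Z))
    (hβ : n * entropy (timeShare n p) (fun v => v.2 v.1) ≤ entropy p (fun ω => ω) + β) :
    pointRate (singleLetterPoint p φ g) ≤ (Real.log (Fintype.card M) / Real.log 2 + β) / n := by
  have hn' : (0 : ℝ) < n := by exact_mod_cast Nat.pos_of_ne_zero hn
  have hA := sum_condEntropy_X_sub_sum_condEntropy_Y (p := p) φ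
  have hB := le_sum_condEntropy_Y φ hp.1
  have hY := entropy_pi_le_timeShare hn hp fun i ω => (ω i).2
  have hMY := entropy_prod_le hp (fun ω => φ fun j => (ω j).1) (fun ω j => (ω j).2)
  have hM := entropy_le_log_card hp (fun ω => φ fun j => (ω j).1)
  rw [← le_div_iff₀ log_two_pos] at hM
  rw [singleLetterPoint_eq, pointRate]
  dsimp only
  rw [condEntropy, entropy_law, entropy_law, entropy_congr (timeShare n p)
    (f := fun v => ((v.2 v.1).1, (v.2 v.1).2)) (g := fun v => v.2 v.1) fun v w => Iff.rfl,
    le_div_iff₀ hn']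
  have e : ∀ b c e : ℝ, (b - c - (n : ℝ)⁻¹ * e) * n = n * b - n * c - e := fun b c e => by
    field_simp
  rw [e]
  linarith

end SingleLetter

/-! ### Conditioning the source on a set of blocks -/

section Conditioned

variable {X Y Z M : Type*} [Fintype X] [Fintype Y] [Fintype Z] [Fintype M] {n : ℕ}

open Classical in
/-- The probability of the event `G` under the i.i.d. law. -/
noncomputable def blockProb (P : X × Y → ℝ) (G : (Fin n → X × Y) → Prop) : ℝ :=
  ∑ ω : Fin n → X × Y, if G ω then ∏ i, P (ω i) else 0

open Classical in
/-- The i.i.d. law conditioned on the event `G`. -/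
noncomputable def conditionedLaw (P : X × Y → ℝ) (G : (Fin n → X × Y) → Prop)
    (ω : Fin n → X × Y) : ℝ :=
  if G ω then (∏ i, P (ω i)) / blockProb P G else 0

theorem conditionedLaw_mem_stdSimplex {P : X × Y → ℝ} (hP : ∀ xy, 0 ≤ P xy)
    {G : (Fin n → X × Y) → Prop} (hG : 0 < blockProb P G) :
    conditionedLaw P G ∈ stdSimplex ℝ (Fin n → X × Y) := by
  classical
  refine ⟨fun ω => ?_, ?_⟩
  · unfold conditionedLaw
    split_ifs
    · exact div_nonneg (prod_nonneg fun i _ => hP _) hG.le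
    · exact le_rfl
  · rw [← div_self hG.ne']
    conv_rhs => enter [1]; unfold blockProb
    rw [sum_div]
    refine sum_congr rfl fun ω _ => ?_
    unfold conditionedLaw
    split_ifs <;> simp

theorem source_ne_zero_of_conditionedLaw_ne_zero {P : X × Y → ℝ} {G : (Fin n → X × Y) → Prop}
    {ω : Fin n → X × Y} (h : conditionedLaw P G ω ≠ 0) (i : Fin n) : P (ω i) ≠ 0 := by
  classical
  intro h0
  refine h ?_
  unfold conditionedLaw
  rw [prod_eq_zero (mem_univ i) h0]
  simp

theorem conditionedLaw_source_support {P : X × Y → ℝ} {G : (Fin n → X × Y) → Prop} {xy : X × Y}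
    (h : P xy = 0) : law (timeShare n (conditionedLaw P G)) (fun v => v.2 v.1) xy = 0 := by
  classical
  refine sum_eq_zero fun v _ => ?_
  split_ifs with hv
  · rw [timeShare]
    by_contra h0
    exact source_ne_zero_of_conditionedLaw_ne_zero (right_ne_zero_of_mul h0) v.1
      ((congrArg P hv).trans h)
  · rfl

/-- On its support the conditioned law is the product pmf divided by `Pr[G]`, so its log-likelihood
is a sum over coordinates plus a constant. This exact formula makes the cost of conditioning `-log
Pr[G]`. -/
theorem entropy_conditionedLaw (hn : n ≠ 0) {P : X × Y → ℝ} (hP : ∀ xy, 0 ≤ P xy)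
    {G : (Fin n → X × Y) → Prop} (hG : 0 < blockProb P G) :
    entropy (conditionedLaw P G) (fun ω => ω) * Real.log 2
      = n * -∑ xy, law (timeShare n (conditionedLaw P G)) (fun v => v.2 v.1) xy * Real.log (P xy)
        + Real.log (blockProb P G) := by
  classical
  have hp := conditionedLaw_mem_stdSimplex hP hG
  have hn' : (n : ℝ) ≠ 0 := by exact_mod_cast hn
  rw [sum_law_mul (timeShare n (conditionedLaw P G)) (fun v => v.2 v.1) fun xy => Real.log (P xy),
    sum_timeShare_mul, mul_neg, mul_inv_cancel_left₀ hn', entropy_mul_log_two, law_id]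
  have h1 : Real.log (blockProb P G)
      = ∑ ω, conditionedLaw P G ω * Real.log (blockProb P G) := by
    rw [← sum_mul, hp.2, one_mul]
  rw [h1, neg_add_eq_sub, ← sum_sub_distrib, ← sum_neg_distrib]
  refine sum_congr rfl fun ω _ => ?_
  by_cases h : conditionedLaw P G ω = 0
  · simp [h]
  have hne := source_ne_zero_of_conditionedLaw_ne_zero h
  have hval : conditionedLaw P G ω = (∏ i, P (ω i)) / blockProb P G := by
    unfold conditionedLaw at h ⊢
    split_ifs at h ⊢ with hω
    · rfl
    · exact absurd rfl h
  have hlog : Real.log (conditionedLaw P G ω)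
      = ∑ i, Real.log (P (ω i)) - Real.log (blockProb P G) := by
    rw [hval, Real.log_div (prod_ne_zero_iff.2 fun i _ => hne i) hG.ne',
      Real.log_prod fun i _ => hne i]
  rw [hlog]
  ring

theorem conditionedLaw_gibbs (hn : n ≠ 0) {P : X × Y → ℝ} (hP : P ∈ stdSimplex ℝ (X × Y))
    {G : (Fin n → X × Y) → Prop} (hG : 0 < blockProb P G) :
    entropy (timeShare n (conditionedLaw P G)) (fun v => v.2 v.1) * Real.log 2
      ≤ -∑ xy, law (timeShare n (conditionedLaw P G)) (fun v => v.2 v.1) xy * Real.log (P xy) := by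
  have hp' := timeShare_mem_stdSimplex hn (conditionedLaw_mem_stdSimplex hP.1 hG)
  rw [entropy_mul_log_two, neg_le_neg_iff]
  refine sum_mul_log_le_sum_mul_log (law_nonneg hp'.1 _) hP.1
    (fun xy h => conditionedLaw_source_support h) ?_
  rw [sum_law, hp'.2, hP.2]

/-- A code whose distortion is at most `D` on an event `G` yields a nearly feasible point whose rate
is nearly that of the code. -/
theorem exists_isFeasiblePoint_of_code (hn : n ≠ 0) {P : X × Y → ℝ}
    (hP : P ∈ stdSimplex ℝ (X × Y)) {d : X → Z → ℝ} {D β : ℝ} {G : (Fin n → X × Y) → Prop}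
    (hG : 0 < blockProb P G) (hβ : -Real.log (blockProb P G) ≤ β * Real.log 2)
    (φ : (Fin n → X) → M) (g : M → (Fin n → Y) → (Fin n → Z))
    (hD : ∀ ω, G ω →
      (1 / (n : ℝ)) * ∑ i, d (ω i).1 (g (φ fun j => (ω j).1) (fun j => (ω j).2) i) ≤ D) :
    ∃ t, IsFeasiblePoint P d D (β / n) t ∧
      pointRate t ≤ (Real.log (Fintype.card M) / Real.log 2 + β) / n := by
  classical
  have hn' : (0 : ℝ) < n := by exact_mod_cast Nat.pos_of_ne_zero hn
  set p := conditionedLaw P G with hpdef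
  have hp : p ∈ stdSimplex ℝ _ := conditionedLaw_mem_stdSimplex hP.1 hG
  have hE := entropy_conditionedLaw hn hP.1 hG
  have hgibbs := conditionedLaw_gibbs hn hP hG
  rw [← hpdef] at hE hgibbs
  have hbase : n * entropy (timeShare n p) (fun v => v.2 v.1)
      ≤ entropy p (fun ω => ω) + β := by
    refine le_of_mul_le_mul_right ?_ log_two_pos
    rw [add_mul, hE, mul_assoc]
    have := mul_le_mul_of_nonneg_left hgibbs hn'.le
    linarith
  have hsrc : law (singleLetterPoint p φ g).1 (fun v => (v.1, v.2.1))
      = law (timeShare n p) (fun v => v.2 v.1) := by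
    rw [singleLetterPoint_eq]
    exact funext fun xy => law_law _ _ _ _
  refine ⟨singleLetterPoint p φ g, ⟨singleLetterPoint_mem φ hn hp g, ?_, ?_,
    singleLetterPoint_markov_left φ hn hp g hbase, singleLetterPoint_markov_right φ hn hp g hbase,
    ?_⟩, pointRate_singleLetterPoint_le φ hn hp g hbase⟩
  · intro xy hxy
    rw [hsrc]
    exact conditionedLaw_source_support hxy
  · have hent : entropy (singleLetterPoint p φ g).1 (fun v => (v.1, v.2.1))
        = entropy (timeShare n p) (fun v => v.2 v.1) := by
      simp only [entropy, hsrc]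
    have hpi := entropy_pi_le_timeShare hn hp fun i ω => ω i
    have hpi' := mul_le_mul_of_nonneg_right hpi log_two_pos.le
    rw [hsrc, hent]
    refine le_of_mul_le_mul_left ?_ hn'
    have e : (n : ℝ) * ((entropy (timeShare n p) (fun v => v.2 v.1) + β / n) * Real.log 2)
        = n * entropy (timeShare n p) (fun v => v.2 v.1) * Real.log 2 + β * Real.log 2 := by
      field_simp
    rw [e]
    linarith
  · rw [singleLetterPoint_eq]
    dsimp only
    rw [sum_law_mul (timeShare n p) _ fun v : X × Y × Z => d v.1 v.2.2, sum_timeShare_mul, mul_sum]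
    calc ∑ ω, (n : ℝ)⁻¹ * (p ω * ∑ i, d (ω i).1 (g (φ fun j => (ω j).1) (fun j => (ω j).2) i))
        ≤ ∑ ω, p ω * D := sum_le_sum fun ω _ => ?_
      _ = D := by rw [← sum_mul, hp.2, one_mul]
    -- Blocks outside `G` carry no conditioned mass, so the distortion bound is needed on `G` only.
    by_cases hω : G ω
    · have := mul_le_mul_of_nonneg_left (hD ω hω) (hp.1 ω)
      rw [one_div] at this
      linarith
    · have : p ω = 0 := by simp [hpdef, conditionedLaw, hω]
      simp [this]

theorem blockProb_not_add_excessProb {Z M : Type*} {P : X × Y → ℝ} (hP : ∑ xy, P xy = 1)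
    (d : X → Z → ℝ) (D : ℝ) (φ : (Fin n → X) → M) (g : M → (Fin n → Y) → (Fin n → Z)) :
    blockProb P (fun ω => ¬ D < (1 / (n : ℝ)) *
        ∑ i, d (ω i).1 (g (φ fun j => (ω j).1) (fun j => (ω j).2) i))
      + excessProb P d D φ g = 1 := by
  classical
  rw [blockProb, excessProb, ← sum_add_distrib]
  calc _ = ∑ ω : Fin n → X × Y, ∏ i, P (ω i) := sum_congr rfl fun ω _ => by
        by_cases h : D < (1 / (n : ℝ)) *
          ∑ i, d (ω i).1 (g (φ fun j => (ω j).1) (fun j => (ω j).2) i)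
        · rw [if_pos h, if_neg (not_not.2 h), zero_add]
        · rw [if_neg h, if_pos h, add_zero]
    _ = 1 := by rw [← Fintype.prod_sum (fun (_ : Fin n) xy => P xy)]; simp [hP]

theorem blockProb_nonneg {P : X × Y → ℝ} (hP : ∀ xy, 0 ≤ P xy) (G : (Fin n → X × Y) → Prop) :
    0 ≤ blockProb P G := by
  classical
  refine sum_nonneg fun ω _ => ?_
  split_ifs
  · exact prod_nonneg fun i _ => hP _
  · exact le_rfl

end Conditioned

/-! ### The strong converse and the main theorem -/

/-- Below an achievable rate there is a feasible rate: the strong converse. -/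
theorem exists_feasibleRate_le_of_achievable {X Y Z : Type*} [Fintype X] [Fintype Y] [Fintype Z]
    {P : X × Y → ℝ} (hP : P ∈ stdSimplex ℝ (X × Y)) {d : X → Z → ℝ} {D ε R : ℝ} (hε : ε < 1)
    (hR : 0 < R) (h : Achievable P d D ε R) : ∃ r ∈ feasibleRates P d D, r ≤ R := by
  obtain ⟨φ, g, hlim⟩ := h
  obtain ⟨c, hεc, hc⟩ := exists_between hε
  -- A real `limsup` yields eventual bounds only for a sequence bounded above.
  have hle : ∀ n, excessProb P d D (φ n) (g n) ≤ 1 := fun n => by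
    have h1 := blockProb_not_add_excessProb hP.2 d D (φ n) (g n)
    have h2 := blockProb_nonneg hP.1 fun ω => ¬ D < (1 / (n : ℝ)) *
        ∑ i, d (ω i).1 (g n (φ n fun j => (ω j).1) (fun j => (ω j).2) i)
    linarith
  have hev : ∀ᶠ n in atTop, excessProb P d D (φ n) (g n) < c :=
    eventually_lt_of_limsup_lt (hlim.trans_lt hεc)
      (isBoundedUnder_of ⟨1, hle⟩)
  obtain ⟨N, hN⟩ := eventually_atTop.1 hev
  -- The good event has probability above `1 - c`, so this is a cost in bits valid for all large
  -- `n`. Blocklengths are written `N + 1 + k` to be both large and nonzero.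
  let β : ℝ := -Real.log (1 - c) / Real.log 2
  have hpoint : ∀ k : ℕ, ∃ t, IsFeasiblePoint P d D (β / (N + 1 + k : ℕ)) t ∧
      pointRate t ≤ (Real.log (Fintype.card (Fin ⌈((N + 1 + k : ℕ) : ℝ) * R⌉₊ → Bool))
        / Real.log 2 + β) / (N + 1 + k : ℕ) := fun k => by
    have h1 := blockProb_not_add_excessProb hP.2 d D (φ (N + 1 + k)) (g (N + 1 + k))
    have h2 := hN (N + 1 + k) (by omega)
    refine exists_isFeasiblePoint_of_code (by omega) hP (G := fun ω => ¬ D <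
      (1 / ((N + 1 + k : ℕ) : ℝ)) * ∑ i, d (ω i).1
        (g (N + 1 + k) (φ (N + 1 + k) fun j => (ω j).1) (fun j => (ω j).2) i)) (by linarith) ?_
      (φ (N + 1 + k)) (g (N + 1 + k)) fun ω hω => not_lt.1 hω
    rw [div_mul_cancel₀ _ log_two_pos.ne', neg_le_neg_iff]
    exact Real.log_le_log (by linarith) (by linarith)
  choose t ht htR using hpoint
  have hzero : ∀ b : ℝ, Tendsto (fun k : ℕ => b / ((N + 1 + k : ℕ) : ℝ)) atTop (𝓝 0) := fun b =>
    (tendsto_const_div_atTop_nhds_zero_nat b).comp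
      (tendsto_atTop_mono (fun k => Nat.le_add_left k (N + 1)) tendsto_id)
  -- The extra `1` in the rate slack pays for rounding `nR` up to an integer number of bits.
  refine exists_feasibleRate_le hP (hzero β) (hzero (1 + β)) ht fun k => (htR k).trans ?_
  have hm : (0 : ℝ) < ((N + 1 + k : ℕ) : ℝ) := by positivity
  have hceil := Nat.ceil_lt_add_one (mul_pos hm hR).le
  have hcard : Real.log (Fintype.card (Fin ⌈((N + 1 + k : ℕ) : ℝ) * R⌉₊ → Bool)) / Real.log 2
      = ⌈((N + 1 + k : ℕ) : ℝ) * R⌉₊ := by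
    rw [Fintype.card_fun, Fintype.card_bool, Fintype.card_fin, Nat.cast_pow, Nat.cast_ofNat,
      Real.log_pow, mul_div_cancel_right₀ _ log_two_pos.ne']
  rw [hcard, div_le_iff₀ hm, add_mul, div_mul_cancel₀ _ hm.ne']
  linarith

end WynerZiv

theorem mainTheorem2 {X Y Z : Type*} [Fintype X] [Fintype Y] [Fintype Z]
    (P : X × Y → ℝ) (hP : P ∈ stdSimplex ℝ (X × Y))
    (d : X → Z → ℝ) (hd : ∀ x z, 0 ≤ d x z) (D : ℝ) (hD : 0 < D) :
    ((WynerZiv.feasibleRates P d D).Nonempty →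
      ∃ r : ℝ, IsLeast (WynerZiv.feasibleRates P d D) r ∧ WynerZiv.Rmin P d D = (r : EReal)) ∧
    ∀ ε R : ℝ, 0 ≤ ε → ε < 1 → 0 < R → (R : EReal) < WynerZiv.Rmin P d D →
      ¬ WynerZiv.Achievable P d D ε R := by
  refine ⟨fun hne => ?_, fun ε R _ hε hR hlt hach => ?_⟩
  · obtain ⟨r, hr⟩ := (WynerZiv.isCompact_feasibleRates hP d D).exists_isLeast hne
    refine ⟨r, hr, le_antisymm (iInf₂_le r hr.1) (le_iInf₂ fun r' hr' => ?_)⟩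
    exact EReal.coe_le_coe_iff.2 (hr.2 hr')
  · obtain ⟨r, hr, hrR⟩ := WynerZiv.exists_feasibleRate_le_of_achievable hP hε hR hach
    have h : WynerZiv.Rmin P d D ≤ (r : EReal) := iInf₂_le r hr
    exact absurd (hlt.trans_le (h.trans (EReal.coe_le_coe_iff.2 hrR))) (lt_irrefl _)
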